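/- Let $\Lambda$ be a non-empty set (finite, countable or uncountable), let $\mathbb{F}^+_\Lambda$ be the free semigroup with unit (the monoid of words) generated by letters $\{z_\alpha\}_{\alpha\in\Lambda}$, and let $\ell^2(\mathbb{F}^+_\Lambda)$ be the complex Hilbert space with orthonormal basis $\{\xi_w : w\in\mathbb{F}^+_\Lambda\}$. For $\alpha\in\Lambda$ let $L_\alpha$ be the isometry of $\ell^2(\mathbb{F}^+_\Lambda)$ with $L_\alpha\xi_w=\xi_{z_\alpha w}$ for all $w$, and let $\mathfrak{L}_\Lambda\subseteq B(\ell^2(\mathbb{F}^+_\Lambda))$ be the left regular free semigroup algebra, that is, the weak-operator closure of the unital algebra generated by $\{L_\alpha\}_{\alpha\in\Lambda}$. A derivation of $\mathfrak{L}_\Lambda$ is a linear map $D\colon\mathfrak{L}_\Lambda\to\mathfrak{L}_\Lambda$ with $D(AB)=A\,D(B)+D(A)\,B$ for all $A,B\in\mathfrak{L}_\Lambda$. It is normal if its restriction to the closed (operator-norm) unit ball of $\mathfrak{L}_\Lambda$ is continuous from the weak-operator topology to the weak-operator topology, and inner if there is $T\in\mathfrak{L}_\Lambda$ with $D(A)=AT-TA$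 for all $A\in\mathfrak{L}_\Lambda$. The inner derivations form a subspace of the space of normal derivations. Theorem. Every normal derivation of $\mathfrak{L}_\Lambda$ is inner. Equivalently, the first normal cohomology group $$\mathscr{H}^1_w(\mathfrak{L}_\Lambda,\mathfrak{L}_\Lambda)=\frac{\{\text{normal derivations of }\mathfrak{L}_\Lambda\}}{\{\text{inner derivations of }\mathfrak{L}_\Lambda\}}$$ is zero. -/

import Mathlib

namespace FreeSemigroupAlgebra

/-- The Hilbert space `ℓ²(𝔽⁺_Λ)`, where the free semigroup (with unit) `𝔽⁺_Λ` is the free monoid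
of words in the letters `Λ`. -/
abbrev FockSpace (Λ : Type*) : Type _ := lp (fun _ : FreeMonoid Λ => ℂ) 2

noncomputable section

open Classical in
/-- The indicator function `ξ_w` of the word `w`. -/
def basisVector {Λ : Type*} (w : FreeMonoid Λ) : FockSpace Λ :=
  lp.single 2 w (1 : ℂ)

theorem inner_basisVector {Λ : Type*} (w v : FreeMonoid Λ) [Decidable (w = v)] :
    inner ℂ (basisVector w) (basisVector v) = if w = v then (1 : ℂ) else 0 := by
  classical
  rw [basisVector, lp.inner_single_left, basisVector, lp.single_apply, Pi.single_apply]
  by_cases h : w = v <;> simp [h]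

theorem orthonormal_basisVector (Λ : Type*) :
    Orthonormal ℂ (basisVector : FreeMonoid Λ → FockSpace Λ) := by
  classical
  rw [orthonormal_iff_ite]
  intro w v
  exact inner_basisVector w v

theorem orthonormal_shift {Λ : Type*} (α : Λ) :
    Orthonormal ℂ (fun w : FreeMonoid Λ => basisVector (FreeMonoid.of α * w)) :=
  (orthonormal_basisVector Λ).comp _ (mul_right_injective (FreeMonoid.of α))

/-- The isometry `L_α` of `ℓ²(𝔽⁺_Λ)` with `L_α ξ_w = ξ_{z_α w}`. -/
def leftCreation {Λ : Type*} (α : Λ) : FockSpace Λ →ₗᵢ[ℂ] FockSpace Λ :=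
  (orthonormal_shift α).orthogonalFamily.linearIsometry

theorem leftCreation_basisVector {Λ : Type*} (α : Λ) (w : FreeMonoid Λ) :
    leftCreation α (basisVector w) = basisVector (FreeMonoid.of α * w) := by
  classical
  rw [leftCreation, basisVector]
  erw [OrthogonalFamily.linearIsometry_apply_single]
  simp

/-- The left regular free semigroup algebra `𝔏_Λ`: the weak-operator closure of the unital algebra
of operators generated by the isometries `L_α`. As a subtype of `B(ℓ²(𝔽⁺_Λ))` with the
weak-operator topology, it carries the weak-operator topology. -/
def leftAlgebra (Λ : Type*) : Subalgebra ℂ (FockSpace Λ →WOT[ℂ] FockSpace Λ) :=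
  (Algebra.adjoin ℂ (Set.range fun α : Λ =>
    ContinuousLinearMapWOT.ofCLM (leftCreation α).toContinuousLinearMap)).topologicalClosure

/-- The closed unit ball of `𝔏_Λ` for the operator norm. -/
def unitBall (Λ : Type*) : Set (leftAlgebra Λ) :=
  {A | ‖(A : FockSpace Λ →WOT[ℂ] FockSpace Λ).toCLM‖ ≤ 1}

/-- A derivation of a complex algebra: a linear map satisfying the Leibniz rule. -/
def IsDerivation {B : Type*} [Ring B] [Algebra ℂ B] (D : B →ₗ[ℂ] B) : Prop :=
  ∀ a b : B, D (a * b) = a * D b + D a * b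

/-- A derivation `D` of a complex algebra is inner if `D = D_t`, `D_t a = a t - t a`,
for some element `t` of the algebra. -/
def IsInner {B : Type*} [Ring B] [Algebra ℂ B] (D : B →ₗ[ℂ] B) : Prop :=
  ∃ t : B, ∀ a : B, D a = a * t - t * a

/-- A normal derivation of `𝔏_Λ`: a derivation that is continuous on the closed unit ball,
both ball and target carrying the weak-operator topology. -/
def IsNormalDerivation {Λ : Type*} (D : leftAlgebra Λ →ₗ[ℂ] leftAlgebra Λ) : Prop :=
  IsDerivation D ∧ ContinuousOn D (unitBall Λ)

/-- The space of all normal derivations of `𝔏_Λ`. -/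
def normalDerivations (Λ : Type*) : Submodule ℂ (leftAlgebra Λ →ₗ[ℂ] leftAlgebra Λ) where
  carrier := {D | IsNormalDerivation D}
  zero_mem' := ⟨fun a b => by simp, continuousOn_const⟩
  add_mem' := by
    rintro D E ⟨hD, hD'⟩ ⟨hE, hE'⟩
    refine ⟨fun a b => ?_, hD'.add hE'⟩
    simp only [LinearMap.add_apply, hD a b, hE a b, mul_add, add_mul]
    abel
  smul_mem' := by
    rintro c D ⟨hD, hD'⟩
    refine ⟨fun a b => ?_, hD'.const_smul c⟩
    simp only [LinearMap.smul_apply, hD a b, smul_add, mul_smul_comm, smul_mul_assoc]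

/-- The space of all inner derivations of `𝔏_Λ`. -/
def innerDerivations (Λ : Type*) : Submodule ℂ (leftAlgebra Λ →ₗ[ℂ] leftAlgebra Λ) where
  carrier := {D | IsInner D}
  zero_mem' := ⟨0, fun a => by simp⟩
  add_mem' := by
    rintro D E ⟨s, hs⟩ ⟨t, ht⟩
    refine ⟨s + t, fun a => ?_⟩
    simp only [LinearMap.add_apply, hs a, ht a, mul_add, add_mul]
    abel
  smul_mem' := by
    rintro c D ⟨s, hs⟩
    refine ⟨c • s, fun a => ?_⟩
    simp only [LinearMap.smul_apply, hs a, smul_sub, mul_smul_comm, smul_mul_assoc]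

/-- Every inner derivation of `𝔏_Λ` is a normal derivation. -/
theorem innerDerivations_le_normalDerivations (Λ : Type*) :
    innerDerivations Λ ≤ normalDerivations Λ := by
  rintro D ⟨t, ht⟩
  refine ⟨fun a b => ?_, Continuous.continuousOn ?_⟩
  · simp only [ht, mul_sub, sub_mul, mul_assoc]
    abel
  · have h : (D : leftAlgebra Λ → leftAlgebra Λ) = fun a => a * t - t * a := funext ht
    rw [h]
    refine Continuous.subtype_mk (f := fun a : leftAlgebra Λ =>
      (a : FockSpace Λ →WOT[ℂ] FockSpace Λ) * t - t * a) ?_ _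
    exact ((continuous_mul_const _).comp continuous_subtype_val).sub
      ((continuous_const_mul _).comp continuous_subtype_val)

instance normalDerivationsAddCommGroup (Λ : Type*) : AddCommGroup (normalDerivations Λ) :=
  (normalDerivations Λ).addCommGroup

/-- The first normal cohomology group of `𝔏_Λ`: the quotient space of normal derivations modulo
inner derivations. -/
abbrev firstNormalCohomology (Λ : Type*) : Type _ :=
  normalDerivations Λ ⧸ (innerDerivations Λ).submoduleOf (normalDerivations Λ)

end

end FreeSemigroupAlgebra

namespace FreeSemigroupAlgebra

noncomputable section

open scoped Topology InnerProductSpace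
open Filter

variable {Λ : Type*}

/-! ### Coordinates in Fock space -/

/-! Every element of `leftAlgebra` commutes with the right creation operators, so it is determined
by its Fourier coefficients, the coordinates of its value at `basisVector 1`. The backward shifts
S_α A = L_α^*(A - A_∅) preserve the algebra. A normal derivation D is norm bounded, since weakly
convergent sequences are bounded. Boundedness is then played against the Leibniz expansion of
D(L_w^n): anything in it that grows with n must vanish.

One letter α: the elements X_n = S_α^n D(L_α^n) are bounded and satisfy an affine recurrence; a weak
limit T of their Cesàro means is a fixed point, which says that S_α kills (D - ad T)(L_α). The terms
of the Leibniz expansion of (D - ad T)(L_α^n) are then orthogonal at the vacuum vector, which forces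
(D - ad T)(L_α) = 0 (`exists_map_gen_eq_ad`).

All letters: suppose D(L_a) = 0 and c ≠ a. Testing D on powers of c a^k shows that D(L_c) lives on
the words c a^l and a^l c (`coeff_map_gen_eq_zero`), with opposite coefficients. Hence f = S_c
D(L_c) is a series in powers of L_a, commutes with L_a, and implements D on L_c. Once D vanishes on
two generators, the support restrictions for both leave only the word c, where the coefficient is
zero; so D vanishes on every generator.

A normal derivation vanishing on generators is zero: A - A_∅ is the weak limit of the bounded finite
sums of L_α S_α(A), so each coefficient of D(A) reduces to one at a shorter word
(`eq_zero_of_forall_map_gen_eq_zero`). -/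

theorem inner_basisVector_left (w : FreeMonoid Λ) (x : FockSpace Λ) :
    inner ℂ (basisVector w) x = x w := by
  classical
  rw [basisVector, lp.inner_single_left]
  simp

theorem basisVector_apply_self (w : FreeMonoid Λ) : (basisVector w : FockSpace Λ) w = 1 := by
  classical
  rw [← inner_basisVector_left, inner_basisVector, if_pos rfl]

theorem basisVector_apply_ne {v w : FreeMonoid Λ} (h : v ≠ w) :
    (basisVector w : FockSpace Λ) v = 0 := by
  classical
  rw [← inner_basisVector_left, inner_basisVector, if_neg h]

theorem norm_basisVector (w : FreeMonoid Λ) : ‖(basisVector w : FockSpace Λ)‖ = 1 :=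
  (orthonormal_basisVector Λ).1 w

theorem continuousLinearMap_ext_basisVector {F : Type*} [NormedAddCommGroup F] [NormedSpace ℂ F]
    {f g : FockSpace Λ →L[ℂ] F} (h : ∀ w, f (basisVector w) = g (basisVector w)) : f = g := by
  classical
  ext x
  have hx := lp.hasSum_single (E := fun _ : FreeMonoid Λ => ℂ) (p := 2) (by simp) x
  have key : ∀ i, lp.single (E := fun _ : FreeMonoid Λ => ℂ) 2 i (x i) = x i • basisVector i := by
    intro i
    rw [basisVector, ← lp.single_smul]
    simp
  simp only [key] at hx
  have h1 := hx.mapL f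
  have h2 := hx.mapL g
  simp only [map_smul, h] at h1 h2
  exact h1.unique h2

theorem apply_of_map_basisVector {φ : FreeMonoid Λ → FreeMonoid Λ} (hφ : Function.Injective φ)
    {T : FockSpace Λ →L[ℂ] FockSpace Λ} (hT : ∀ w, T (basisVector w) = basisVector (φ w))
    (x : FockSpace Λ) (w : FreeMonoid Λ) : T x (φ w) = x w := by
  classical
  have h : (innerSL ℂ (basisVector (φ w))).comp T = innerSL ℂ (basisVector w) := by
    refine continuousLinearMap_ext_basisVector fun v => ?_
    simp only [ContinuousLinearMap.comp_apply, hT, innerSL_apply_apply, inner_basisVector,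
      hφ.eq_iff]
  have := congrArg (fun f => f x) h
  simpa only [ContinuousLinearMap.comp_apply, innerSL_apply_apply, inner_basisVector_left]
    using this

theorem apply_of_map_basisVector_of_notMem {φ : FreeMonoid Λ → FreeMonoid Λ}
    {T : FockSpace Λ →L[ℂ] FockSpace Λ} (hT : ∀ w, T (basisVector w) = basisVector (φ w))
    (x : FockSpace Λ) {u : FreeMonoid Λ} (hu : ∀ w, u ≠ φ w) : T x u = 0 := by
  classical
  have h : (innerSL ℂ (basisVector u)).comp T = 0 := by
    refine continuousLinearMap_ext_basisVector fun v => ?_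
    simp only [ContinuousLinearMap.comp_apply, hT, innerSL_apply_apply, inner_basisVector,
      if_neg (hu v), zero_apply]
  have := congrArg (fun f => f x) h
  simpa only [ContinuousLinearMap.comp_apply, innerSL_apply_apply, inner_basisVector_left,
    zero_apply] using this

/-! ### Left and right creation operators -/

/-- The isometry `R_u` with `R_u ξ_w = ξ_{wu}`. -/
def rightCreation (u : FreeMonoid Λ) : FockSpace Λ →ₗᵢ[ℂ] FockSpace Λ :=
  ((orthonormal_basisVector Λ).comp (fun w => w * u)
    (mul_left_injective u)).orthogonalFamily.linearIsometry

theorem rightCreation_basisVector (u w : FreeMonoid Λ) :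
    rightCreation u (basisVector w) = basisVector (w * u) := by
  classical
  rw [rightCreation, basisVector]
  erw [OrthogonalFamily.linearIsometry_apply_single]
  simp

theorem rightCreation_apply_mul (u w : FreeMonoid Λ) (x : FockSpace Λ) :
    rightCreation u x (w * u) = x w :=
  apply_of_map_basisVector (φ := fun w => w * u) (mul_left_injective u)
    (T := (rightCreation u).toContinuousLinearMap) (rightCreation_basisVector u) x w

theorem rightCreation_apply_of_notMem (u : FreeMonoid Λ) (x : FockSpace Λ) {v : FreeMonoid Λ}
    (hv : ∀ w, v ≠ w * u) : rightCreation u x v = 0 :=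
  apply_of_map_basisVector_of_notMem (φ := fun w => w * u)
    (T := (rightCreation u).toContinuousLinearMap) (rightCreation_basisVector u) x hv

/-- The operator `L_α` with the weak-operator topology on its ambient space. -/
def leftOp (α : Λ) : FockSpace Λ →WOT[ℂ] FockSpace Λ :=
  ContinuousLinearMapWOT.ofCLM (leftCreation α).toContinuousLinearMap

theorem leftOp_mem (α : Λ) : leftOp α ∈ leftAlgebra Λ :=
  Subalgebra.le_topologicalClosure _ (Algebra.subset_adjoin ⟨α, rfl⟩)

/-- The generator `L_α` of the left regular free semigroup algebra. -/
def gen (α : Λ) : leftAlgebra Λ := ⟨leftOp α, leftOp_mem α⟩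

/-- The operator `L_w` of the left regular free semigroup algebra given by a word `w`. -/
def word : FreeMonoid Λ →* leftAlgebra Λ := FreeMonoid.lift gen

@[simp]
theorem word_of (α : Λ) : word (FreeMonoid.of α) = gen α := FreeMonoid.lift_eval_of _ _

theorem word_apply_basisVector (u w : FreeMonoid Λ) :
    (word u : FockSpace Λ →WOT[ℂ] FockSpace Λ) (basisVector w) = basisVector (u * w) := by
  induction u using FreeMonoid.inductionOn' generalizing w with
  | one => simp
  | of_mul α u ih =>
    rw [map_mul, word_of, mul_assoc, ← leftCreation_basisVector, ← ih]
    rfl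

theorem word_apply_mul (u w : FreeMonoid Λ) (x : FockSpace Λ) :
    (word u : FockSpace Λ →WOT[ℂ] FockSpace Λ) x (u * w) = x w :=
  apply_of_map_basisVector (φ := fun w => u * w) (mul_right_injective u)
    (T := (word u : FockSpace Λ →WOT[ℂ] FockSpace Λ).toCLM) (word_apply_basisVector u) x w

theorem word_apply_of_notMem (u : FreeMonoid Λ) (x : FockSpace Λ) {v : FreeMonoid Λ}
    (hv : ∀ w, v ≠ u * w) : (word u : FockSpace Λ →WOT[ℂ] FockSpace Λ) x v = 0 :=
  apply_of_map_basisVector_of_notMem (φ := fun w => u * w)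
    (T := (word u : FockSpace Λ →WOT[ℂ] FockSpace Λ).toCLM) (word_apply_basisVector u) x hv

/-- Left and right multiplication of words commute, and the commutant of one operator is weakly
closed because multiplication is separately continuous. -/
theorem commute_rightCreation (A : leftAlgebra Λ) (u : FreeMonoid Λ) (x : FockSpace Λ) :
    (A : FockSpace Λ →WOT[ℂ] FockSpace Λ) (rightCreation u x) =
      rightCreation u ((A : FockSpace Λ →WOT[ℂ] FockSpace Λ) x) := by
  let R : FockSpace Λ →WOT[ℂ] FockSpace Λ :=
    ContinuousLinearMapWOT.ofCLM (rightCreation u).toContinuousLinearMap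
  have hle : leftAlgebra Λ ≤ Subalgebra.centralizer ℂ {R} := by
    refine Subalgebra.topologicalClosure_minimal (Algebra.adjoin_le ?_) ?_
    · rintro _ ⟨α, rfl⟩
      rw [SetLike.mem_coe, Subalgebra.mem_centralizer_iff]
      rintro _ rfl
      refine ContinuousLinearMapWOT.toCLM_injective ?_
      refine continuousLinearMap_ext_basisVector fun w => ?_
      change rightCreation u (leftCreation α _) = leftCreation α (rightCreation u _)
      rw [rightCreation_basisVector, leftCreation_basisVector, leftCreation_basisVector,
        rightCreation_basisVector, mul_assoc]
    · have : ((Subalgebra.centralizer ℂ {R} : Subalgebra ℂ (FockSpace Λ →WOT[ℂ] FockSpace Λ)) :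
          Set (FockSpace Λ →WOT[ℂ] FockSpace Λ)) = {A | R * A = A * R} := by
        ext A
        rw [SetLike.mem_coe, Subalgebra.mem_centralizer_iff]
        simp
      rw [this]
      exact isClosed_eq (continuous_const_mul _) (continuous_mul_const _)
  have h := (Subalgebra.mem_centralizer_iff ℂ).1 (hle A.2) R rfl
  exact (congrArg (fun T : FockSpace Λ →WOT[ℂ] FockSpace Λ => T x) h).symm

/-! ### Fourier coefficients -/

/-- The vector `A ξ_∅`. -/
def vec : leftAlgebra Λ →ₗ[ℂ] FockSpace Λ where
  toFun A := (A : FockSpace Λ →WOT[ℂ] FockSpace Λ) (basisVector 1)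
  map_add' _ _ := rfl
  map_smul' _ _ := rfl

/-- The Fourier coefficient of `A` at the word `w`. -/
def coeff (w : FreeMonoid Λ) : leftAlgebra Λ →ₗ[ℂ] ℂ where
  toFun A := vec A w
  map_add' _ _ := by rw [map_add]; rfl
  map_smul' _ _ := by rw [map_smul]; rfl

theorem coeff_apply (w : FreeMonoid Λ) (A : leftAlgebra Λ) : coeff w A = vec A w := rfl

theorem apply_basisVector (A : leftAlgebra Λ) (w : FreeMonoid Λ) :
    (A : FockSpace Λ →WOT[ℂ] FockSpace Λ) (basisVector w) = rightCreation w (vec A) := by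
  change _ = rightCreation w ((A : FockSpace Λ →WOT[ℂ] FockSpace Λ) (basisVector 1))
  rw [← commute_rightCreation, rightCreation_basisVector, one_mul]

theorem continuous_coeff (w : FreeMonoid Λ) : Continuous (coeff (Λ := Λ) w) := by
  have h : (coeff (Λ := Λ) w : leftAlgebra Λ → ℂ) = fun A : leftAlgebra Λ =>
      inner ℂ (basisVector w) ((A : FockSpace Λ →WOT[ℂ] FockSpace Λ) (basisVector 1)) := by
    ext A
    rw [inner_basisVector_left]
    rfl
  rw [h]
  exact (ContinuousLinearMapWOT.continuous_dual_apply (basisVector 1)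
    (innerSL ℂ (basisVector w))).comp (continuous_subtype_val (p := (· ∈ leftAlgebra Λ)))

theorem vec_injective : Function.Injective (vec : leftAlgebra Λ → FockSpace Λ) := by
  intro A B h
  refine Subtype.ext (ContinuousLinearMapWOT.toCLM_injective ?_)
  refine continuousLinearMap_ext_basisVector fun w => ?_
  change (A : FockSpace Λ →WOT[ℂ] FockSpace Λ) _ = (B : FockSpace Λ →WOT[ℂ] FockSpace Λ) _
  rw [apply_basisVector, apply_basisVector, h]

theorem ext_coeff {A B : leftAlgebra Λ} (h : ∀ w, coeff w A = coeff w B) : A = B :=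
  vec_injective (lp.ext (funext h))

theorem vec_mul_word (A : leftAlgebra Λ) (u : FreeMonoid Λ) :
    vec (A * word u) = rightCreation u (vec A) := by
  rw [← apply_basisVector, ← mul_one u, ← word_apply_basisVector, mul_one]
  rfl

theorem coeff_word_mul (u w : FreeMonoid Λ) (A : leftAlgebra Λ) :
    coeff (u * w) (word u * A) = coeff w A := word_apply_mul u w (vec A)

theorem coeff_word_mul_of_notMem (u : FreeMonoid Λ) (A : leftAlgebra Λ) {v : FreeMonoid Λ}
    (hv : ∀ w, v ≠ u * w) : coeff v (word u * A) = 0 := word_apply_of_notMem u (vec A) hv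

theorem coeff_mul_word (u w : FreeMonoid Λ) (A : leftAlgebra Λ) :
    coeff (w * u) (A * word u) = coeff w A := by
  rw [coeff_apply, vec_mul_word, rightCreation_apply_mul, coeff_apply]

theorem coeff_mul_word_of_notMem (u : FreeMonoid Λ) (A : leftAlgebra Λ) {v : FreeMonoid Λ}
    (hv : ∀ w, v ≠ w * u) : coeff v (A * word u) = 0 := by
  rw [coeff_apply, vec_mul_word, rightCreation_apply_of_notMem u _ hv]

theorem coeff_word_self (w : FreeMonoid Λ) : coeff w (word w) = 1 := by
  have : vec (word w) = basisVector w := by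
    rw [← mul_one w, ← word_apply_basisVector, mul_one]
    rfl
  rw [coeff_apply, this, basisVector_apply_self]

theorem coeff_word_ne {v w : FreeMonoid Λ} (h : v ≠ w) : coeff v (word w) = 0 := by
  have : vec (word w) = basisVector w := by
    rw [← mul_one w, ← word_apply_basisVector, mul_one]
    rfl
  rw [coeff_apply, this, basisVector_apply_ne h]

theorem coeff_one_ne {v : FreeMonoid Λ} (h : v ≠ 1) : coeff v (1 : leftAlgebra Λ) = 0 := by
  rw [← map_one word, coeff_word_ne h]

theorem coeff_one_one : coeff (1 : FreeMonoid Λ) (1 : leftAlgebra Λ) = 1 := by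
  rw [← map_one word, coeff_word_self]

theorem coeff_gen_mul (α : Λ) (w : FreeMonoid Λ) (A : leftAlgebra Λ) :
    coeff (FreeMonoid.of α * w) (gen α * A) = coeff w A := by
  rw [← word_of, coeff_word_mul]

theorem coeff_mul_gen (α : Λ) (w : FreeMonoid Λ) (A : leftAlgebra Λ) :
    coeff (w * FreeMonoid.of α) (A * gen α) = coeff w A := by
  rw [← word_of, coeff_mul_word]

theorem coeff_gen_mul_of_notMem (α : Λ) (A : leftAlgebra Λ) {v : FreeMonoid Λ}
    (hv : ∀ w, v ≠ FreeMonoid.of α * w) : coeff v (gen α * A) = 0 := by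
  rw [← word_of, coeff_word_mul_of_notMem _ _ hv]

theorem coeff_mul_gen_of_notMem (α : Λ) (A : leftAlgebra Λ) {v : FreeMonoid Λ}
    (hv : ∀ w, v ≠ w * FreeMonoid.of α) : coeff v (A * gen α) = 0 := by
  rw [← word_of, coeff_mul_word_of_notMem _ _ hv]

theorem one_ne_of_mul (α : Λ) (w : FreeMonoid Λ) : (1 : FreeMonoid Λ) ≠ FreeMonoid.of α * w :=
  fun h => by
    have := congrArg FreeMonoid.length h
    simp only [FreeMonoid.length_one, FreeMonoid.length_mul, FreeMonoid.length_of] at this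
    omega

theorem one_ne_mul_of (α : Λ) (w : FreeMonoid Λ) : (1 : FreeMonoid Λ) ≠ w * FreeMonoid.of α :=
  fun h => by
    have := congrArg FreeMonoid.length h
    simp only [FreeMonoid.length_one, FreeMonoid.length_mul, FreeMonoid.length_of] at this
    omega

theorem coeff_one_gen_mul (α : Λ) (A : leftAlgebra Λ) : coeff 1 (gen α * A) = 0 :=
  coeff_gen_mul_of_notMem α A fun w => one_ne_of_mul α w

theorem coeff_one_mul_gen (α : Λ) (A : leftAlgebra Λ) : coeff 1 (A * gen α) = 0 :=
  coeff_mul_gen_of_notMem α A fun w => one_ne_mul_of α w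

/-- The empty word arises only from the empty word, so the vacuum vector is an eigenvector of the
adjoint of `A`. This makes `coeff 1` a character. -/
theorem apply_one (A : leftAlgebra Λ) (x : FockSpace Λ) :
    (A : FockSpace Λ →WOT[ℂ] FockSpace Λ) x 1 = coeff 1 A * x 1 := by
  have h : (innerSL ℂ (basisVector 1)).comp (A : FockSpace Λ →WOT[ℂ] FockSpace Λ).toCLM =
      coeff 1 A • innerSL ℂ (basisVector 1) := by
    refine continuousLinearMap_ext_basisVector fun w => ?_
    simp only [ContinuousLinearMap.comp_apply, innerSL_apply_apply, inner_basisVector_left,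
      smul_apply, ContinuousLinearMapWOT.toCLM_apply, apply_basisVector]
    rcases eq_or_ne w 1 with rfl | hw
    · rw [basisVector_apply_self, smul_eq_mul, mul_one]
      exact rightCreation_apply_mul 1 1 _
    · rw [basisVector_apply_ne hw.symm, smul_zero, rightCreation_apply_of_notMem]
      intro v hv
      have := congrArg FreeMonoid.length hv
      simp only [FreeMonoid.length_one, FreeMonoid.length_mul] at this
      exact hw (FreeMonoid.length_eq_zero.1 (by omega))
  have := congrArg (fun f => f x) h
  simpa only [ContinuousLinearMap.comp_apply, innerSL_apply_apply, inner_basisVector_left,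
    smul_apply, smul_eq_mul, ContinuousLinearMapWOT.toCLM_apply] using this

theorem coeff_one_mul (A B : leftAlgebra Λ) : coeff 1 (A * B) = coeff 1 A * coeff 1 B :=
  apply_one A (vec B)

/-! ### The operator norm -/

/-- The operator norm of an element of the left regular free semigroup algebra. -/
def opNorm (A : leftAlgebra Λ) : ℝ := ‖(A : FockSpace Λ →WOT[ℂ] FockSpace Λ).toCLM‖

theorem opNorm_nonneg (A : leftAlgebra Λ) : 0 ≤ opNorm A := norm_nonneg _

theorem mem_unitBall {A : leftAlgebra Λ} : A ∈ unitBall Λ ↔ opNorm A ≤ 1 := Iff.rfl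

theorem opNorm_add_le (A B : leftAlgebra Λ) : opNorm (A + B) ≤ opNorm A + opNorm B :=
  norm_add_le _ _

theorem opNorm_sub_le (A B : leftAlgebra Λ) : opNorm (A - B) ≤ opNorm A + opNorm B :=
  norm_sub_le _ _

theorem opNorm_mul_le (A B : leftAlgebra Λ) : opNorm (A * B) ≤ opNorm A * opNorm B :=
  norm_mul_le _ _

theorem opNorm_smul (c : ℂ) (A : leftAlgebra Λ) : opNorm (c • A) = ‖c‖ * opNorm A :=
  norm_smul _ _

theorem norm_apply_le (A : leftAlgebra Λ) (x : FockSpace Λ) :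
    ‖(A : FockSpace Λ →WOT[ℂ] FockSpace Λ) x‖ ≤ opNorm A * ‖x‖ :=
  (A : FockSpace Λ →WOT[ℂ] FockSpace Λ).toCLM.le_opNorm x

theorem norm_vec_le (A : leftAlgebra Λ) : ‖vec A‖ ≤ opNorm A := by
  refine (norm_apply_le A (basisVector 1)).trans_eq ?_
  rw [norm_basisVector, mul_one]

theorem norm_coeff_le (w : FreeMonoid Λ) (A : leftAlgebra Λ) : ‖coeff w A‖ ≤ opNorm A :=
  (lp.norm_apply_le_norm (by simp) (vec A) w).trans (norm_vec_le A)

theorem opNorm_gen_le (α : Λ) : opNorm (gen α) ≤ 1 :=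
  (leftCreation α).norm_toContinuousLinearMap_le

theorem opNorm_one_le : opNorm (1 : leftAlgebra Λ) ≤ 1 := ContinuousLinearMap.norm_id_le

theorem opNorm_word_le (w : FreeMonoid Λ) : opNorm (word w) ≤ 1 := by
  induction w using FreeMonoid.inductionOn' with
  | one => rw [map_one]; exact opNorm_one_le
  | of_mul α u ih =>
    rw [map_mul, word_of]
    exact (opNorm_mul_le _ _).trans (mul_le_one₀ (opNorm_gen_le α) (opNorm_nonneg _) ih)

/-! ### Backward shifts -/

theorem star_leftOp_mul_leftOp (α : Λ) : star (leftOp α) * leftOp α = 1 := by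
  refine ContinuousLinearMapWOT.ext_inner fun x y => ?_
  change inner ℂ y ((leftCreation α).toContinuousLinearMap.adjoint (leftCreation α x)) = _
  rw [ContinuousLinearMap.adjoint_inner_right]
  exact (leftCreation α).inner_map_map y x

theorem star_leftOp_apply (α : Λ) (x : FockSpace Λ) (w : FreeMonoid Λ) :
    star (leftOp α) x w = x (FreeMonoid.of α * w) := by
  rw [← inner_basisVector_left, ← inner_basisVector_left]
  change inner ℂ _ ((leftCreation α).toContinuousLinearMap.adjoint x) = _
  rw [ContinuousLinearMap.adjoint_inner_right]
  change inner ℂ (leftCreation α _) x = _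
  rw [leftCreation_basisVector]

theorem star_leftOp_mul_leftOp_of_ne {α β : Λ} (h : α ≠ β) : star (leftOp α) * leftOp β = 0 := by
  refine ContinuousLinearMapWOT.toCLM_injective ?_
  refine continuousLinearMap_ext_basisVector fun v => lp.ext (funext fun w => ?_)
  change star (leftOp α) (leftCreation β (basisVector v)) w = 0
  rw [star_leftOp_apply, leftCreation_basisVector, basisVector_apply_ne]
  intro hw
  have := congrArg FreeMonoid.toList hw
  simp only [FreeMonoid.toList_of_mul, List.cons.injEq] at this
  exact h this.1

theorem continuous_algebraMap_wot :
    Continuous (algebraMap ℂ (FockSpace Λ →WOT[ℂ] FockSpace Λ)) := by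
  refine ContinuousLinearMapWOT.continuous_of_dual_apply_continuous fun x y => ?_
  simp only [ContinuousLinearMapWOT.algebraMapCLM_apply, map_smul]
  exact continuous_id.smul continuous_const

/-- The map Φ is weakly continuous, so it is enough that it preserves the algebra generated by the
L_α; there it obeys a twisted Leibniz rule and sends each generator to 0 or 1. -/
theorem star_leftOp_mul_mem (α : Λ) (A : leftAlgebra Λ) :
    star (leftOp α) * ((A : FockSpace Λ →WOT[ℂ] FockSpace Λ) - algebraMap ℂ _ (coeff 1 A)) ∈
      leftAlgebra Λ := by
  let c : (FockSpace Λ →WOT[ℂ] FockSpace Λ) → ℂ := fun T =>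
    inner ℂ (basisVector 1) (T (basisVector 1))
  let Φ : (FockSpace Λ →WOT[ℂ] FockSpace Λ) → (FockSpace Λ →WOT[ℂ] FockSpace Λ) := fun T =>
    star (leftOp α) * (T - algebraMap ℂ _ (c T))
  have hc : Continuous c := ContinuousLinearMapWOT.continuous_dual_apply (basisVector 1)
    (innerSL ℂ (basisVector 1))
  have hcA : ∀ A : leftAlgebra Λ, c A = coeff 1 A := fun A => inner_basisVector_left _ _
  have hΦ : Continuous Φ :=
    (continuous_const_mul _).comp (continuous_id.sub (continuous_algebraMap_wot.comp hc))
  let 𝒜 := Algebra.adjoin ℂ (Set.range fun α : Λ => leftOp α)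
  have h𝒜 : ∀ T ∈ 𝒜, T ∈ leftAlgebra Λ := fun T hT => Subalgebra.le_topologicalClosure _ hT
  have hmem : ∀ T ∈ 𝒜, Φ T ∈ 𝒜 := by
    intro T hT
    refine Algebra.adjoin_induction (p := fun T _ => Φ T ∈ 𝒜) ?_ ?_ ?_ ?_ hT
    · rintro _ ⟨β, rfl⟩
      have h0 : c (leftOp β) = 0 := by
        rw [show leftOp β = (gen β : leftAlgebra Λ) from rfl, hcA, ← mul_one (gen β),
          coeff_one_gen_mul]
      simp only [Φ, h0, map_zero, sub_zero]
      rcases eq_or_ne α β with rfl | h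
      · rw [star_leftOp_mul_leftOp]
        exact one_mem _
      · rw [star_leftOp_mul_leftOp_of_ne h]
        exact zero_mem _
    · intro r
      have h0 : c (algebraMap ℂ _ r) = r := by
        change inner ℂ (basisVector 1) (r • basisVector 1) = r
        rw [inner_smul_right, inner_basisVector_left, basisVector_apply_self, mul_one]
      simp only [Φ, h0, sub_self, mul_zero]
      exact zero_mem _
    · intro S T _ _ hS hT
      have : Φ (S + T) = Φ S + Φ T := by
        have h0 : c (S + T) = c S + c T := by
          simp only [c, ContinuousLinearMapWOT.add_apply, inner_add_right]
        simp only [Φ, h0, map_add]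
        rw [add_sub_add_comm, mul_add]
      rw [this]
      exact add_mem hS hT
    · intro S T hS' hT' hS hT
      -- This comes from ST - c(S)c(T) = (S - c(S))T + c(S)(T - c(T)).
      have : Φ (S * T) = Φ S * T + Φ T * algebraMap ℂ _ (c S) := by
        have h0 : c (S * T) = c S * c T := by
          have := coeff_one_mul ⟨S, h𝒜 S hS'⟩ ⟨T, h𝒜 T hT'⟩
          rwa [← hcA, ← hcA, ← hcA] at this
        simp only [Φ, h0, map_mul, mul_assoc, ← mul_add]
        congr 1
        rw [Algebra.commutes (c S) (algebraMap ℂ _ (c T)), sub_mul, sub_mul,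
          Algebra.commutes (c S) T]
        abel
      rw [this]
      exact add_mem (mul_mem hS hT') (mul_mem hT (𝒜.algebraMap_mem _))
  have h := map_mem_closure hΦ (show (A : FockSpace Λ →WOT[ℂ] FockSpace Λ) ∈ closure (𝒜 : Set _)
    from A.2) hmem
  simp only [Φ, hcA] at h
  exact h

/-- The backward shift `A ↦ L_α^* (A - A_∅)`, where `A_∅` is the Fourier coefficient of `A` at the
empty word. -/
def backShift (α : Λ) : leftAlgebra Λ →ₗ[ℂ] leftAlgebra Λ where
  toFun A := ⟨_, star_leftOp_mul_mem α A⟩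
  map_add' A B := by
    refine Subtype.ext ?_
    simp only [map_add, Subalgebra.coe_add]
    rw [add_sub_add_comm, mul_add]
  map_smul' r A := by
    refine Subtype.ext ?_
    have h : coeff 1 (r • A) = r * coeff 1 A := map_smul _ _ _
    simp only [h, map_mul, RingHom.id_apply]
    rw [Algebra.smul_def, Algebra.smul_def]
    change _ * (algebraMap ℂ _ r * _ - _) = algebraMap ℂ _ r * (_ * _)
    rw [← mul_sub, ← mul_assoc, ← mul_assoc, Algebra.commutes r (star (leftOp α))]

theorem coe_backShift (α : Λ) (A : leftAlgebra Λ) :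
    (backShift α A : FockSpace Λ →WOT[ℂ] FockSpace Λ) = star (leftOp α) *
      ((A : FockSpace Λ →WOT[ℂ] FockSpace Λ) - algebraMap ℂ _ (coeff 1 A)) := rfl

theorem coe_backShift_of_coeff_one {α : Λ} {A : leftAlgebra Λ} (h : coeff 1 A = 0) :
    (backShift α A : FockSpace Λ →WOT[ℂ] FockSpace Λ) = star (leftOp α) * A := by
  rw [coe_backShift, h, map_zero, sub_zero]

theorem continuous_backShift (α : Λ) : Continuous (backShift α) := by
  have hf : Continuous fun A : leftAlgebra Λ => star (leftOp α) *
      ((A : FockSpace Λ →WOT[ℂ] FockSpace Λ) - algebraMap ℂ _ (coeff 1 A)) :=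
    (continuous_const_mul _).comp
      (continuous_subtype_val.sub (continuous_algebraMap_wot.comp (continuous_coeff 1)))
  exact hf.subtype_mk _

theorem coeff_backShift (α : Λ) (A : leftAlgebra Λ) (w : FreeMonoid Λ) :
    coeff w (backShift α A) = coeff (FreeMonoid.of α * w) A := by
  have h : vec (backShift α A) = star (leftOp α) (vec (A - coeff 1 A • 1)) := by
    change (backShift α A : FockSpace Λ →WOT[ℂ] FockSpace Λ) _ = _
    rw [coe_backShift]
    rfl
  rw [coeff_apply, h, star_leftOp_apply, ← coeff_apply, map_sub, map_smul,
    coeff_one_ne (one_ne_of_mul α w).symm, smul_zero, sub_zero]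

theorem norm_star_leftOp_le (α : Λ) : ‖(star (leftOp α)).toCLM‖ ≤ 1 := by
  change ‖(leftCreation α).toContinuousLinearMap.adjoint‖ ≤ 1
  rw [LinearIsometryEquiv.norm_map]
  exact (leftCreation α).norm_toContinuousLinearMap_le

theorem opNorm_backShift_le {α : Λ} {A : leftAlgebra Λ} (h : coeff 1 A = 0) :
    opNorm (backShift α A) ≤ opNorm A := by
  rw [opNorm, coe_backShift_of_coeff_one h]
  exact (norm_mul_le _ _).trans (mul_le_of_le_one_left (norm_nonneg _) (norm_star_leftOp_le α))

theorem backShift_gen_mul (α : Λ) (A : leftAlgebra Λ) : backShift α (gen α * A) = A :=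
  ext_coeff fun w => by rw [coeff_backShift, coeff_gen_mul]

theorem backShift_mul_of_coeff_one {α : Λ} {A : leftAlgebra Λ} (h : coeff 1 A = 0)
    (B : leftAlgebra Λ) : backShift α (A * B) = backShift α A * B := by
  refine Subtype.ext ?_
  rw [coe_backShift_of_coeff_one (by rw [coeff_one_mul, h, zero_mul]), Subalgebra.coe_mul,
    Subalgebra.coe_mul, coe_backShift_of_coeff_one h, mul_assoc]

/-! ### Bounded sequences in the weak operator topology -/

/-- Uniform boundedness applies twice: to the functionals given by `T n x` for fixed `x`, then to
the operators. -/
theorem exists_norm_le_of_tendsto_wot {E : Type*} [NormedAddCommGroup E] [InnerProductSpace ℂ E]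
    [CompleteSpace E] {T : ℕ → E →WOT[ℂ] E} {A : E →WOT[ℂ] E} (h : Tendsto T atTop (𝓝 A)) :
    ∃ C, ∀ n, ‖(T n).toCLM‖ ≤ C := by
  rw [ContinuousLinearMapWOT.tendsto_iff_forall_inner_apply_tendsto] at h
  refine banach_steinhaus fun x => ?_
  obtain ⟨C, hC⟩ := banach_steinhaus (g := fun n => innerSL ℂ (T n x)) fun y => by
    obtain ⟨C, hC⟩ := (Metric.isBounded_range_of_tendsto _ (h x y)).exists_norm_le
    refine ⟨C, fun n => ?_⟩
    rw [innerSL_apply_apply, norm_inner_symm]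
    exact hC _ ⟨n, rfl⟩
  refine ⟨C, fun n => ?_⟩
  simpa only [innerSL_apply_norm, ContinuousLinearMapWOT.toCLM_apply] using hC n

/-- Matrix coefficients converge along the ultrafilter by compactness of discs, and their limits
form a bounded sesquilinear form, hence come from an operator. -/
theorem exists_tendsto_wot_of_norm_le {E : Type*} [NormedAddCommGroup E] [InnerProductSpace ℂ E]
    [CompleteSpace E] (F : Ultrafilter ℕ) {T : ℕ → E →WOT[ℂ] E} {C : ℝ}
    (hT : ∀ n, ‖(T n).toCLM‖ ≤ C) : ∃ A, Tendsto T F (𝓝 A) := by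
  have hb : ∀ v w n, ‖inner ℂ (T n v) w‖ ≤ C * ‖v‖ * ‖w‖ := fun v w n =>
    (norm_inner_le_norm _ _).trans (mul_le_mul_of_nonneg_right
      ((T n).toCLM.le_of_opNorm_le (hT n) v) (norm_nonneg _))
  have hl : ∀ v w, ∃ l, Tendsto (fun n => inner ℂ (T n v) w) F (𝓝 l) := by
    intro v w
    obtain ⟨l, -, hl⟩ := (isCompact_closedBall (0 : ℂ) (C * ‖v‖ * ‖w‖)).ultrafilter_le_nhds
      (F.map fun n => inner ℂ (T n v) w) (by
        rw [Filter.le_principal_iff]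
        refine Filter.mem_map.2 (Filter.Eventually.of_forall fun n => ?_)
        simpa using hb v w n)
    exact ⟨l, hl⟩
  choose l hl using hl
  have huniq : ∀ {v w c}, Tendsto (fun n => inner ℂ (T n v) w) F (𝓝 c) → l v w = c :=
    fun h => tendsto_nhds_unique (hl _ _) h
  let B : E →L⋆[ℂ] E →L[ℂ] ℂ := LinearMap.mkContinuous₂
    (LinearMap.mk₂'ₛₗ (starRingEnd ℂ) (RingHom.id ℂ) l
      (fun v v' w => huniq (by
        simpa only [map_add, inner_add_left] using (hl v w).add (hl v' w)))
      (fun c v w => huniq (by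
        simpa only [map_smul, inner_smul_left, smul_eq_mul] using (hl v w).const_mul _))
      (fun v w w' => huniq (by
        simpa only [inner_add_right] using (hl v w).add (hl v w')))
      (fun c v w => huniq (by
        simpa only [inner_smul_right, smul_eq_mul, RingHom.id_apply] using
          (hl v w).const_mul c)))
    C (fun v w => le_of_tendsto (hl v w).norm (Eventually.of_forall fun n => hb v w n))
  refine ⟨.ofCLM (InnerProductSpace.continuousLinearMapOfBilin B), ?_⟩
  rw [ContinuousLinearMapWOT.tendsto_iff_forall_inner_apply_tendsto]
  intro x y
  have h1 := (hl x y).star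
  have h2 : inner ℂ y (InnerProductSpace.continuousLinearMapOfBilin B x) = star (l x y) := by
    rw [← inner_conj_symm, InnerProductSpace.continuousLinearMapOfBilin_apply]
    rfl
  rw [ContinuousLinearMapWOT.ofCLM_apply, h2]
  refine h1.congr fun n => ?_
  exact inner_conj_symm _ _

theorem exists_tendsto_of_opNorm_le (F : Ultrafilter ℕ) {T : ℕ → leftAlgebra Λ} {C : ℝ}
    (hT : ∀ n, opNorm (T n) ≤ C) : ∃ A : leftAlgebra Λ, Tendsto T F (𝓝 A) := by
  obtain ⟨A, hA⟩ := exists_tendsto_wot_of_norm_le F hT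
  have hmem : A ∈ leftAlgebra Λ := by
    have hcl : IsClosed (leftAlgebra Λ : Set (FockSpace Λ →WOT[ℂ] FockSpace Λ)) :=
      Subalgebra.isClosed_topologicalClosure _
    exact hcl.mem_of_tendsto hA (Eventually.of_forall fun n => (T n).2)
  exact ⟨⟨A, hmem⟩, tendsto_subtype_rng.2 hA⟩

theorem tendsto_zero_of_opNorm {T : ℕ → leftAlgebra Λ} {l : Filter ℕ}
    (h : Tendsto (fun n => opNorm (T n)) l (𝓝 0)) : Tendsto T l (𝓝 0) := by
  refine tendsto_subtype_rng.2 ?_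
  have h' : Tendsto (fun n => (T n : FockSpace Λ →WOT[ℂ] FockSpace Λ).toCLM) l (𝓝 0) :=
    tendsto_zero_iff_norm_tendsto_zero.2 h
  exact (ContinuousLinearMapWOT.continuous_ofCLM.tendsto 0).comp h'

/-! ### Bounded derivations -/

/-- Boundedness of a linear map for the operator norm. -/
def IsOpBounded (D : leftAlgebra Λ →ₗ[ℂ] leftAlgebra Λ) : Prop :=
  ∃ M, ∀ A, opNorm A ≤ 1 → opNorm (D A) ≤ M

theorem IsNormalDerivation.isOpBounded {D : leftAlgebra Λ →ₗ[ℂ] leftAlgebra Λ}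
    (hD : IsNormalDerivation D) : IsOpBounded D := by
  by_contra hcon
  simp only [IsOpBounded, not_exists, not_forall, not_le] at hcon
  -- With the square, dividing by n + 1 sends the inputs to zero in norm while the images still have
  -- norm above n + 1.
  choose A hA hDA using fun n : ℕ => hcon (((n : ℝ) + 1) ^ 2)
  let c : ℕ → ℂ := fun n => ((1 / ((n : ℝ) + 1) : ℝ) : ℂ)
  have hc : ∀ n, ‖c n‖ = 1 / ((n : ℝ) + 1) := fun n => by
    rw [Complex.norm_real, Real.norm_of_nonneg (by positivity)]
  have hle : ∀ n, opNorm (c n • A n) ≤ 1 / ((n : ℝ) + 1) := fun n => by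
    rw [opNorm_smul, hc]
    exact mul_le_of_le_one_right (by positivity) (hA n)
  have hball : ∀ n, c n • A n ∈ unitBall Λ := fun n => by
    refine (hle n).trans ?_
    rw [div_le_one (by positivity)]
    linarith [(Nat.cast_nonneg n : (0 : ℝ) ≤ n)]
  have h0 : Tendsto (fun n => c n • A n) atTop (𝓝 0) := tendsto_zero_of_opNorm
    (squeeze_zero (fun n => opNorm_nonneg _) hle tendsto_one_div_add_atTop_nhds_zero_nat)
  have hzero : (0 : leftAlgebra Λ) ∈ unitBall Λ := by
    change ‖(0 : FockSpace Λ →L[ℂ] FockSpace Λ)‖ ≤ 1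
    simp
  have h1 : Tendsto (fun n => D (c n • A n)) atTop (𝓝 (D 0)) :=
    (hD.2 0 hzero).tendsto.comp (tendsto_nhdsWithin_iff.2 ⟨h0, Eventually.of_forall hball⟩)
  obtain ⟨C, hC⟩ := exists_norm_le_of_tendsto_wot
    ((continuous_subtype_val.tendsto (D 0)).comp h1)
  obtain ⟨n, hn⟩ := exists_nat_gt C
  have h2 : opNorm (D (c n • A n)) ≤ C := hC n
  rw [map_smul, opNorm_smul, hc, one_div, inv_mul_le_iff₀ (by positivity)] at h2
  nlinarith [hDA n]

/-- The inner derivation `A ↦ A t - t A`. -/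
def ad (t : leftAlgebra Λ) : leftAlgebra Λ →ₗ[ℂ] leftAlgebra Λ where
  toFun A := A * t - t * A
  map_add' A B := by rw [add_mul, mul_add]; abel
  map_smul' c A := by rw [RingHom.id_apply, smul_mul_assoc, mul_smul_comm, smul_sub]

theorem ad_apply (t A : leftAlgebra Λ) : ad t A = A * t - t * A := rfl

theorem isNormalDerivation_ad (t : leftAlgebra Λ) : IsNormalDerivation (ad t) :=
  innerDerivations_le_normalDerivations Λ ⟨t, fun _ => rfl⟩

theorem IsNormalDerivation.sub_ad {D : leftAlgebra Λ →ₗ[ℂ] leftAlgebra Λ}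
    (hD : IsNormalDerivation D) (t : leftAlgebra Λ) : IsNormalDerivation (D - ad t) :=
  (normalDerivations Λ).sub_mem hD (isNormalDerivation_ad t)

theorem IsDerivation.map_one {B : Type*} [Ring B] [Algebra ℂ B] {D : B →ₗ[ℂ] B}
    (hD : IsDerivation D) : D 1 = 0 := by
  have := hD 1 1
  rw [mul_one, one_mul, mul_one] at this
  simpa using this

/-! ### Vanishing of Fourier coefficients at powers of a letter -/

/-- The word `α^n`. -/
abbrev letterPow (α : Λ) (n : ℕ) : FreeMonoid Λ := FreeMonoid.of α ^ n

theorem eq_zero_of_forall_nat_mul_le {x M : ℝ} (hx : 0 ≤ x) (h : ∀ n : ℕ, (n : ℝ) * x ≤ M) :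
    x = 0 := by
  by_contra hne
  obtain ⟨n, hn⟩ := exists_nat_gt (M / x)
  rw [div_lt_iff₀ (lt_of_le_of_ne hx (Ne.symm hne))] at hn
  exact absurd (h n) (not_le.2 hn)

theorem coeff_letterPow_gen_mul {α : Λ} {A : leftAlgebra Λ} (h : ∀ m, coeff (letterPow α m) A = 0)
    (m : ℕ) : coeff (letterPow α m) (gen α * A) = 0 := by
  cases m with
  | zero => exact coeff_one_gen_mul α A
  | succ m => rw [letterPow, pow_succ', coeff_gen_mul, h]

theorem coeff_letterPow_mul_gen {α : Λ} {A : leftAlgebra Λ} (h : ∀ m, coeff (letterPow α m) A = 0)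
    (m : ℕ) : coeff (letterPow α m) (A * gen α) = 0 := by
  cases m with
  | zero => exact coeff_one_mul_gen α A
  | succ m => rw [letterPow, pow_succ, coeff_mul_gen, h]

/-- Each of the n + 1 Leibniz terms of D(L_α^{n+1}) contributes the same amount at α^{m+n}, so a
nonzero coefficient would contradict boundedness. -/
theorem coeff_letterPow_map_gen {D : leftAlgebra Λ →ₗ[ℂ] leftAlgebra Λ} (hD : IsDerivation D)
    (hb : IsOpBounded D) (α : Λ) (m : ℕ) : coeff (letterPow α m) (D (gen α)) = 0 := by
  obtain ⟨M, hM⟩ := hb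
  have key : ∀ n : ℕ, coeff (letterPow α (m + n)) (D (gen α ^ (n + 1))) =
      ((n : ℂ) + 1) * coeff (letterPow α m) (D (gen α)) := by
    intro n
    induction n with
    | zero => simp
    | succ n ih =>
      rw [pow_succ _ (n + 1), hD, map_add]
      have h1 : coeff (letterPow α (m + (n + 1))) (gen α ^ (n + 1) * D (gen α)) =
          coeff (letterPow α m) (D (gen α)) := by
        rw [← word_of, ← map_pow, add_comm, letterPow, pow_add, coeff_word_mul]
      have h2 : coeff (letterPow α (m + (n + 1))) (D (gen α ^ (n + 1)) * gen α) =
          coeff (letterPow α (m + n)) (D (gen α ^ (n + 1))) := by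
        rw [← add_assoc, letterPow, pow_succ, coeff_mul_gen]
      rw [h1, h2, ih]
      push_cast
      ring
  have hle : ∀ n : ℕ, (n : ℝ) * ‖coeff (letterPow α m) (D (gen α))‖ ≤ M := by
    intro n
    have h1 : opNorm (gen α ^ (n + 1)) ≤ 1 := by
      rw [← word_of, ← map_pow]
      exact opNorm_word_le _
    have h2 := (norm_coeff_le (letterPow α (m + n)) _).trans (hM _ h1)
    rw [key, norm_mul] at h2
    refine le_trans (mul_le_mul_of_nonneg_right ?_ (norm_nonneg _)) h2
    have : ((n : ℂ) + 1) = ((n + 1 : ℕ) : ℂ) := by push_cast; rfl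
    rw [this, Complex.norm_natCast]
    push_cast
    linarith
  exact norm_eq_zero.1 (eq_zero_of_forall_nat_mul_le (norm_nonneg _) hle)

/-- With these coefficients gone, every iterate of S_α on D(L_α^n) has zero vacuum coefficient.
There S_α is just multiplication by L_α^*: it does not increase the norm and commutes with right
multiplication. -/
theorem coeff_letterPow_map_pow {D : leftAlgebra Λ →ₗ[ℂ] leftAlgebra Λ} (hD : IsDerivation D)
    (hb : IsOpBounded D) (α : Λ) (n m : ℕ) : coeff (letterPow α m) (D (gen α ^ n)) = 0 := by
  induction n generalizing m with
  | zero => rw [pow_zero, hD.map_one, map_zero]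
  | succ n ih =>
    have h : ∀ k m, coeff (letterPow α m) (gen α ^ k * D (gen α)) = 0 := by
      intro k
      induction k with
      | zero => intro m; rw [pow_zero, one_mul, coeff_letterPow_map_gen hD hb]
      | succ k ihk =>
        intro m
        rw [pow_succ', mul_assoc]
        exact coeff_letterPow_gen_mul ihk m
    rw [pow_succ, hD, map_add, h, coeff_letterPow_mul_gen ih, add_zero]

/-! ### A normal derivation is inner on each generator -/

theorem backShift_pow_pow_mul (α : Λ) (n : ℕ) (A : leftAlgebra Λ) :
    (backShift α ^ n) (gen α ^ n * A) = A := by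
  induction n with
  | zero => rw [pow_zero, pow_zero, one_mul, Module.End.one_apply]
  | succ n ih =>
    rw [pow_succ, Module.End.mul_apply, pow_succ', mul_assoc, backShift_gen_mul, ih]

theorem coeff_letterPow_backShift {α : Λ} {A : leftAlgebra Λ}
    (h : ∀ m, coeff (letterPow α m) A = 0) (m : ℕ) :
    coeff (letterPow α m) (backShift α A) = 0 := by
  rw [coeff_backShift, letterPow, ← pow_succ', h]

theorem coeff_letterPow_backShift_pow {α : Λ} {A : leftAlgebra Λ}
    (h : ∀ m, coeff (letterPow α m) A = 0) (n m : ℕ) :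
    coeff (letterPow α m) ((backShift α ^ n) A) = 0 := by
  induction n generalizing m with
  | zero => exact h m
  | succ n ih =>
    rw [pow_succ', Module.End.mul_apply]
    exact coeff_letterPow_backShift ih m

theorem opNorm_backShift_pow_le {α : Λ} {A : leftAlgebra Λ}
    (h : ∀ m, coeff (letterPow α m) A = 0) (n : ℕ) :
    opNorm ((backShift α ^ n) A) ≤ opNorm A := by
  induction n with
  | zero => exact le_rfl
  | succ n ih =>
    rw [pow_succ', Module.End.mul_apply]
    exact (opNorm_backShift_le (coeff_letterPow_backShift_pow h n 0)).trans ih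

theorem backShift_pow_mul {α : Λ} {A : leftAlgebra Λ}
    (h : ∀ m, coeff (letterPow α m) A = 0) (n : ℕ) (B : leftAlgebra Λ) :
    (backShift α ^ n) (A * B) = (backShift α ^ n) A * B := by
  induction n with
  | zero => rfl
  | succ n ih =>
    rw [pow_succ', Module.End.mul_apply, Module.End.mul_apply, ih,
      backShift_mul_of_coeff_one (coeff_letterPow_backShift_pow h n 0)]

theorem continuous_leftAlgebra_mul_const (B : leftAlgebra Λ) :
    Continuous fun A : leftAlgebra Λ => A * B :=
  ((continuous_mul_const (B : FockSpace Λ →WOT[ℂ] FockSpace Λ)).comp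
    continuous_subtype_val).subtype_mk _

theorem opNorm_sum_le {ι : Type*} (s : Finset ι) (f : ι → leftAlgebra Λ) :
    opNorm (∑ i ∈ s, f i) ≤ ∑ i ∈ s, opNorm (f i) := by
  classical
  induction s using Finset.induction_on with
  | empty =>
    simp only [Finset.sum_empty]
    exact (norm_zero (E := FockSpace Λ →L[ℂ] FockSpace Λ)).le
  | insert i s hi ih =>
    rw [Finset.sum_insert hi, Finset.sum_insert hi]
    exact (opNorm_add_le _ _).trans (add_le_add_right ih _)

/-- The fixed-point equation for the Cesàro limit of the bounded orbit of the affine map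
`X ↦ S B + S X L_α`, where `S` is the backward shift. -/
theorem exists_eq_backShift_add {α : Λ} {B : leftAlgebra Λ} {X : ℕ → leftAlgebra Λ} {M : ℝ}
    (hM : ∀ n, opNorm (X n) ≤ M) (h1 : ∀ n, coeff 1 (X n) = 0)
    (hX : ∀ n, X (n + 1) = backShift α B + backShift α (X n) * gen α) :
    ∃ T, coeff 1 T = 0 ∧ T = backShift α B + backShift α T * gen α := by
  let c : ℕ → ℂ := fun N => ((1 / ((N : ℝ) + 1) : ℝ) : ℂ)
  have hc : ∀ n, ‖c n‖ = 1 / ((n : ℝ) + 1) := fun n => by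
    rw [Complex.norm_real, Real.norm_of_nonneg (by positivity)]
  have hc' : ∀ n, c n * ((n : ℂ) + 1) = 1 := fun n => by
    simp only [c]
    push_cast
    rw [one_div, inv_mul_cancel₀]
    exact_mod_cast n.succ_ne_zero
  let Y : ℕ → leftAlgebra Λ := fun N => c N • ∑ n ∈ Finset.range (N + 1), X n
  have hY : ∀ N, opNorm (Y N) ≤ M := by
    intro N
    rw [opNorm_smul, hc, one_div, inv_mul_le_iff₀ (by positivity)]
    refine (opNorm_sum_le _ _).trans ((Finset.sum_le_card_nsmul _ _ M fun n _ => hM n).trans_eq ?_)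
    rw [Finset.card_range, nsmul_eq_mul]
    push_cast
    rfl
  obtain ⟨T, hT⟩ := exists_tendsto_of_opNorm_le (hyperfilter ℕ) hY
  refine ⟨T, ?_, ?_⟩
  · have h := ((continuous_coeff 1).tendsto T).comp hT
    refine tendsto_nhds_unique h ((tendsto_const_nhds (x := (0 : ℂ))).congr fun N => ?_)
    simp only [Y, Function.comp_apply, map_smul, map_sum, h1, Finset.sum_const_zero, smul_zero]
  · have hrel : ∀ N, Y N + c N • (X (N + 1) - X 0) =
        backShift α B + backShift α (Y N) * gen α := by
      intro N
      have e1 : Y N + c N • (X (N + 1) - X 0) =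
          c N • ∑ n ∈ Finset.range (N + 1), X (n + 1) := by
        simp only [Y]
        rw [← smul_add]
        congr 1
        have := Finset.sum_range_succ' X (N + 1)
        rw [eq_sub_of_add_eq this.symm, Finset.sum_range_succ X (N + 1)]
        abel
      rw [e1]
      simp only [hX, Finset.sum_add_distrib, Finset.sum_const, Finset.card_range, smul_add, Y,
        map_smul, map_sum, ← Finset.sum_mul, smul_mul_assoc]
      congr 1
      rw [← Nat.cast_smul_eq_nsmul ℂ, smul_smul]
      push_cast
      rw [hc', one_smul]
    have hzero : Tendsto (fun N => c N • (X (N + 1) - X 0)) atTop (𝓝 0) := by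
      refine tendsto_zero_of_opNorm (squeeze_zero (fun _ => opNorm_nonneg _)
        (g := fun N : ℕ => 1 / ((N : ℝ) + 1) * (M + M)) (fun N => ?_) ?_)
      · rw [opNorm_smul, hc]
        exact mul_le_mul_of_nonneg_left
          ((opNorm_sub_le _ _).trans (add_le_add (hM _) (hM _))) (by positivity)
      · simpa using tendsto_one_div_add_atTop_nhds_zero_nat.mul_const (M + M)
    -- The ultrafilter must be non-principal for the boundary term to vanish along it.
    have hle : ((hyperfilter ℕ : Ultrafilter ℕ) : Filter ℕ) ≤ atTop := by
      rw [← Nat.cofinite_eq_atTop]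
      exact hyperfilter_le_cofinite
    have hcont : Continuous fun A : leftAlgebra Λ => backShift α B + backShift α A * gen α :=
      continuous_const.add ((continuous_leftAlgebra_mul_const _).comp (continuous_backShift α))
    have hl := hT.add (hzero.mono_left hle)
    simp only [hrel, add_zero] at hl
    exact tendsto_nhds_unique hl ((hcont.tendsto T).comp hT)

/-- The hypothesis makes the range of D(L_α) orthogonal to that of L_α. Pythagoras applied to
D(L_α^{n+1}) = L_α D(L_α^n) + D(L_α) L_α^n gives linear growth of the squared norm at the vacuum
vector, against boundedness. -/
theorem map_gen_eq_zero_of_backShift_eq_zero {D : leftAlgebra Λ →ₗ[ℂ] leftAlgebra Λ}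
    (hD : IsNormalDerivation D) {α : Λ} (h : backShift α (D (gen α)) = 0) : D (gen α) = 0 := by
  have hcoeff : coeff 1 (D (gen α)) = 0 := coeff_letterPow_map_gen hD.1 hD.isOpBounded α 0
  have hstar : star (leftOp α) * (D (gen α) : FockSpace Λ →WOT[ℂ] FockSpace Λ) = 0 := by
    rw [← coe_backShift_of_coeff_one hcoeff, h]
    rfl
  have key : ∀ n : ℕ, ‖vec (D (gen α ^ n))‖ ^ 2 = n * ‖vec (D (gen α))‖ ^ 2 := by
    intro n
    induction n with
    | zero => simp [hD.1.map_one]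
    | succ n ih =>
      rw [pow_succ' (gen α), hD.1, map_add]
      have horth : inner ℂ (vec (gen α * D (gen α ^ n))) (vec (D (gen α) * gen α ^ n)) = 0 := by
        change inner ℂ ((leftCreation α).toContinuousLinearMap (vec (D (gen α ^ n))))
          ((D (gen α) : FockSpace Λ →WOT[ℂ] FockSpace Λ) (vec (gen α ^ n))) = 0
        rw [← ContinuousLinearMap.adjoint_inner_right]
        have : (leftCreation α).toContinuousLinearMap.adjoint
            ((D (gen α) : FockSpace Λ →WOT[ℂ] FockSpace Λ) (vec (gen α ^ n))) = 0 :=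
          congrArg (fun T : FockSpace Λ →WOT[ℂ] FockSpace Λ => T (vec (gen α ^ n))) hstar
        rw [this, inner_zero_right]
      have h1 : ‖vec (gen α * D (gen α ^ n))‖ = ‖vec (D (gen α ^ n))‖ :=
        (leftCreation α).norm_map _
      have h2 : ‖vec (D (gen α) * gen α ^ n)‖ = ‖vec (D (gen α))‖ := by
        rw [← word_of, ← map_pow, vec_mul_word]
        exact (rightCreation _).norm_map _
      have h3 := norm_add_sq_eq_norm_sq_add_norm_sq_of_inner_eq_zero _ _ horth
      rw [sq, h3, h1, h2, ← sq, ← sq, ih]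
      push_cast
      ring
  obtain ⟨M, hM⟩ := hD.isOpBounded
  have hle : ∀ n : ℕ, (n : ℝ) * ‖vec (D (gen α))‖ ^ 2 ≤ M ^ 2 := by
    intro n
    rw [← key]
    refine pow_le_pow_left₀ (norm_nonneg _) ((norm_vec_le _).trans (hM _ ?_)) 2
    rw [← word_of, ← map_pow]
    exact opNorm_word_le _
  have h0 := eq_zero_of_forall_nat_mul_le (sq_nonneg _) hle
  refine vec_injective ?_
  rw [map_zero, ← norm_eq_zero]
  exact pow_eq_zero_iff two_ne_zero |>.1 h0

/-- A normal derivation agrees on each generator with an inner derivation. -/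
theorem exists_map_gen_eq_ad {D : leftAlgebra Λ →ₗ[ℂ] leftAlgebra Λ}
    (hD : IsNormalDerivation D) (α : Λ) : ∃ T, D (gen α) = ad T (gen α) := by
  obtain ⟨M, hM⟩ := hD.isOpBounded
  have hv : ∀ n m, coeff (letterPow α m) (D (gen α ^ n)) = 0 :=
    coeff_letterPow_map_pow hD.1 hD.isOpBounded α
  -- If D were `ad T`, this sequence would be T minus the n-fold shift of T L_α^n, so it is a
  -- natural approximation to an implementing element.
  obtain ⟨T, hT1, hT⟩ := exists_eq_backShift_add (α := α) (B := D (gen α))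
    (X := fun n => (backShift α ^ n) (D (gen α ^ n))) (M := M)
    (fun n => (opNorm_backShift_pow_le (hv n) n).trans (hM _ (by
      rw [← word_of, ← map_pow]
      exact opNorm_word_le _)))
    (fun n => coeff_letterPow_backShift_pow (hv n) n 0)
    (fun n => by
      rw [pow_succ (gen α), hD.1, map_add, pow_succ', Module.End.mul_apply, Module.End.mul_apply,
        backShift_pow_pow_mul, backShift_pow_mul (hv n),
        backShift_mul_of_coeff_one (coeff_letterPow_backShift_pow (hv n) n 0)])
  refine ⟨T, ?_⟩
  -- The fixed-point equation for T says exactly that S_α annihilates D(L_α) - L_α T + T L_α.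
  have h := map_gen_eq_zero_of_backShift_eq_zero (hD.sub_ad T) (α := α) (by
    rw [LinearMap.sub_apply, ad_apply, map_sub, map_sub, backShift_gen_mul,
      backShift_mul_of_coeff_one hT1]
    rw [sub_sub_eq_add_sub, ← hT, sub_self])
  rwa [LinearMap.sub_apply, sub_eq_zero] at h

/-! ### Combinatorics of words -/

theorem of_mul_inj {a c : Λ} {u v : FreeMonoid Λ} :
    FreeMonoid.of a * u = FreeMonoid.of c * v ↔ a = c ∧ u = v := by
  refine ⟨fun h => ?_, by rintro ⟨rfl, rfl⟩; rfl⟩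
  have := congrArg FreeMonoid.toList h
  rw [FreeMonoid.toList_of_mul, FreeMonoid.toList_of_mul, List.cons.injEq] at this
  exact ⟨this.1, FreeMonoid.toList.injective this.2⟩

theorem mul_of_inj {a c : Λ} {u v : FreeMonoid Λ} :
    u * FreeMonoid.of a = v * FreeMonoid.of c ↔ u = v ∧ a = c := by
  refine ⟨fun h => ?_, by rintro ⟨rfl, rfl⟩; rfl⟩
  have := congrArg FreeMonoid.toList h
  rw [FreeMonoid.toList_mul, FreeMonoid.toList_mul, FreeMonoid.toList_of, FreeMonoid.toList_of,
    List.append_singleton_inj] at this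
  exact ⟨FreeMonoid.toList.injective this.1, this.2⟩

theorem letterPow_mul_eq_of_mul {a c : Λ} (hac : a ≠ c) {l : ℕ} {u v : FreeMonoid Λ}
    (h : letterPow a l * u = FreeMonoid.of c * v) : l = 0 := by
  cases l with
  | zero => rfl
  | succ l =>
    rw [letterPow, pow_succ', mul_assoc, of_mul_inj] at h
    exact absurd h.1 hac

theorem mul_letterPow_eq_mul_of {a c : Λ} (hac : a ≠ c) {l : ℕ} {u v : FreeMonoid Λ}
    (h : u * letterPow a l = v * FreeMonoid.of c) : l = 0 := by
  cases l with
  | zero => rfl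
  | succ l =>
    rw [letterPow, pow_succ, ← mul_assoc, mul_of_inj] at h
    exact absurd h.2 hac

theorem exists_of_mul_eq_mul_of_length_le {u v x y : FreeMonoid Λ} (h : u * x = v * y)
    (hl : v.length ≤ u.length) : ∃ z, u = v * z := by
  have h' : u.toList ++ x.toList = v.toList ++ y.toList := congrArg FreeMonoid.toList h
  have hp : v.toList <+: u.toList := by
    refine List.prefix_of_prefix_length_le (l₃ := u.toList ++ x.toList) ?_
      (List.prefix_append _ _) hl
    rw [h']
    exact List.prefix_append _ _
  obtain ⟨z, hz⟩ := hp
  exact ⟨FreeMonoid.ofList z, FreeMonoid.toList.injective hz.symm⟩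

theorem eq_letterPow_of_mul_eq {a : Λ} {k : ℕ} {u v : FreeMonoid Λ} (h : u * v = letterPow a k) :
    ∃ l ≤ k, u = letterPow a l := by
  induction k generalizing u with
  | zero =>
    have := congrArg FreeMonoid.length h
    simp only [FreeMonoid.length_mul, pow_zero, FreeMonoid.length_one] at this
    exact ⟨0, le_rfl, FreeMonoid.length_eq_zero.1 (by omega)⟩
  | succ k ih =>
    induction u using FreeMonoid.casesOn with
    | one => exact ⟨0, Nat.zero_le _, rfl⟩
    | of_mul b u =>
      rw [letterPow, pow_succ', mul_assoc, of_mul_inj] at h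
      obtain ⟨l, hl, rfl⟩ := ih h.2
      exact ⟨l + 1, by omega, by rw [h.1, letterPow, letterPow, pow_succ']⟩

theorem length_letterPow (a : Λ) (k : ℕ) : (letterPow a k).length = k := by
  induction k with
  | zero => rfl
  | succ k ih => rw [letterPow, pow_succ, FreeMonoid.length_mul, ih, FreeMonoid.length_of]

/-- The word `c a^k`. -/
abbrev spacedWord (a c : Λ) (k : ℕ) : FreeMonoid Λ := FreeMonoid.of c * letterPow a k

/-- The block a^k is longer than `v'`, so `v'` must be a prefix of c a^k. It is nonempty, because
the right side would otherwise begin with a. Cancelling it determines `v`. -/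
theorem spacedWord_pow_mul_eq {a c : Λ} (hac : a ≠ c) {k m : ℕ} {v v' : FreeMonoid Λ}
    (hk : v'.length < k)
    (h : spacedWord a c k ^ (m + 1) * (v * letterPow a k) =
      v' * letterPow a k * spacedWord a c k ^ (m + 1)) :
    ∃ l, v' = FreeMonoid.of c * letterPow a l ∧ v = letterPow a l * FreeMonoid.of c := by
  have hlen := length_letterPow a k
  have h1 : spacedWord a c k * (spacedWord a c k ^ m * (v * letterPow a k)) =
      v' * (letterPow a k * spacedWord a c k ^ (m + 1)) := by
    rw [← mul_assoc, ← pow_succ', h, mul_assoc]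
  obtain ⟨z, hz⟩ := exists_of_mul_eq_mul_of_length_le h1 (by
    rw [spacedWord, FreeMonoid.length_mul, hlen]
    omega)
  induction v' using FreeMonoid.casesOn with
  | one =>
    rw [one_mul, spacedWord, mul_assoc] at h1
    have := letterPow_mul_eq_of_mul hac h1.symm
    omega
  | of_mul b p =>
    rw [spacedWord, mul_assoc, of_mul_inj] at hz
    obtain ⟨rfl, hz⟩ := hz
    obtain ⟨l, hl, rfl⟩ := eq_letterPow_of_mul_eq hz.symm
    refine ⟨l, rfl, ?_⟩
    have h2 : letterPow a k * (spacedWord a c k ^ m * (v * letterPow a k)) =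
        letterPow a k * (letterPow a l * (spacedWord a c k ^ m * spacedWord a c k)) := by
      rw [spacedWord, mul_assoc, mul_assoc, of_mul_inj] at h1
      rw [h1.2, ← pow_succ, ← mul_assoc, ← mul_assoc, letterPow, letterPow, pow_mul_comm]
    have h3 := mul_left_cancel h2
    have h4 : spacedWord a c k ^ m * v =
        letterPow a l * spacedWord a c k ^ m * FreeMonoid.of c := by
      refine mul_right_cancel (b := letterPow a k) ?_
      rw [mul_assoc, h3]
      simp only [mul_assoc]
    -- For a positive exponent both sides can be compared at their first letter: one starts with a^l
    -- c, the other with c, so l = 0.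
    cases m with
    | zero => simpa using h4
    | succ m =>
      have h5 : letterPow a l * (spacedWord a c k ^ (m + 1) * FreeMonoid.of c) =
          FreeMonoid.of c * (letterPow a k * (spacedWord a c k ^ m * v)) := by
        rw [← mul_assoc, ← h4, pow_succ']
        simp only [mul_assoc]
      obtain rfl := letterPow_mul_eq_of_mul hac h5
      rw [letterPow, pow_zero, one_mul] at h4 ⊢
      exact mul_left_cancel h4

/-- Cancelling the common outer powers when i ≠ j leaves the equation of `spacedWord_pow_mul_eq`.
The case i < j forces `v` to be c a^l, the case j < i forces it to be a^l c. -/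
theorem spacedWord_sandwich_inj {a c : Λ} (hac : a ≠ c) {v v' : FreeMonoid Λ}
    (hv : ∀ l, v ≠ FreeMonoid.of c * letterPow a l)
    (hv' : ∀ l, v ≠ letterPow a l * FreeMonoid.of c) {k n i j : ℕ} (hk : v.length < k)
    (hi : i < n) (hj : j < n)
    (h : spacedWord a c k ^ i * v * (letterPow a k * spacedWord a c k ^ (n - 1 - i)) =
      spacedWord a c k ^ j * v' * (letterPow a k * spacedWord a c k ^ (n - 1 - j))) :
    i = j ∧ v = v' := by
  have hlen : v'.length = v.length := by
    have h1 := congrArg FreeMonoid.length h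
    have hpow : ∀ i, (spacedWord a c k ^ i).length = i * (k + 1) := by
      intro i
      induction i with
      | zero => simp
      | succ i ih =>
        rw [pow_succ, FreeMonoid.length_mul, ih, spacedWord, FreeMonoid.length_mul,
          length_letterPow, FreeMonoid.length_of]
        ring
    simp only [FreeMonoid.length_mul, hpow] at h1
    have h2 : i * (k + 1) + (n - 1 - i) * (k + 1) = j * (k + 1) + (n - 1 - j) * (k + 1) := by
      rw [← add_mul, ← add_mul]
      congr 1
      omega
    omega
  rcases lt_trichotomy i j with hij | rfl | hij
  · obtain ⟨m, rfl⟩ := Nat.exists_eq_add_of_lt hij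
    have e : n - 1 - i = (m + 1) + (n - 1 - (i + m + 1)) := by omega
    rw [e, add_assoc i m 1, pow_add _ i, pow_add _ (m + 1), mul_assoc, mul_assoc, mul_assoc] at h
    have h1 := mul_left_cancel h
    simp only [← mul_assoc] at h1
    have h2 := mul_right_cancel h1
    obtain ⟨l, hl, -⟩ := spacedWord_pow_mul_eq hac hk (m := m) (v := v') (v' := v)
      (by rw [h2]; simp only [mul_assoc])
    exact absurd hl (hv l)
  · refine ⟨rfl, ?_⟩
    rw [mul_assoc, mul_assoc] at h
    exact mul_right_cancel (mul_left_cancel h)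
  · obtain ⟨m, rfl⟩ := Nat.exists_eq_add_of_lt hij
    have e : n - 1 - j = (m + 1) + (n - 1 - (j + m + 1)) := by omega
    rw [e, add_assoc j m 1, pow_add _ j, pow_add _ (m + 1), mul_assoc, mul_assoc, mul_assoc] at h
    have h1 := mul_left_cancel h
    simp only [← mul_assoc] at h1
    have h2 := mul_right_cancel h1
    obtain ⟨l, -, hl⟩ := spacedWord_pow_mul_eq hac (hlen.trans_lt hk) (m := m) (v := v) (v' := v')
      (by rw [← h2]; simp only [mul_assoc])
    exact absurd hl (hv' l)

/-! ### Support of the derivative of a generator -/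

theorem IsDerivation.map_pow {B : Type*} [Ring B] [Algebra ℂ B] {D : B →ₗ[ℂ] B}
    (hD : IsDerivation D) (x : B) (n : ℕ) :
    D (x ^ n) = ∑ i ∈ Finset.range n, x ^ i * D x * x ^ (n - 1 - i) := by
  induction n with
  | zero => simp [hD.map_one]
  | succ n ih =>
    rw [pow_succ', hD, ih, Finset.sum_range_succ', Finset.mul_sum, pow_zero, one_mul]
    congr 1
    refine Finset.sum_congr rfl fun i _ => ?_
    rw [pow_succ', show n + 1 - 1 - (i + 1) = n - 1 - i by omega]
    simp only [mul_assoc]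

theorem coeff_word_mul_word (x v y : FreeMonoid Λ) (A : leftAlgebra Λ) :
    coeff (x * v * y) (word x * A * word y) = coeff v A := by
  rw [coeff_mul_word, coeff_word_mul]

theorem coeff_word_mul_word_of_notMem {x y u : FreeMonoid Λ} (A : leftAlgebra Λ)
    (h : ∀ v, u ≠ x * v * y) : coeff u (word x * A * word y) = 0 := by
  by_cases hy : ∃ w, u = w * y
  · obtain ⟨w, rfl⟩ := hy
    rw [coeff_mul_word]
    refine coeff_word_mul_of_notMem _ _ fun v hv => h v ?_
    rw [hv]
  · exact coeff_mul_word_of_notMem _ _ fun w hw => hy ⟨w, hw⟩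

theorem sum_norm_coeff_sq_le {n : ℕ} {w : Fin n → FreeMonoid Λ} (hw : Function.Injective w)
    (A : leftAlgebra Λ) : ∑ i, ‖coeff (w i) A‖ ^ 2 ≤ opNorm A ^ 2 := by
  have h := ((orthonormal_basisVector Λ).comp w hw).sum_inner_products_le (vec A)
    (s := Finset.univ)
  simp only [Function.comp_apply, inner_basisVector_left] at h
  exact h.trans (pow_le_pow_left₀ (norm_nonneg _) (norm_vec_le A) 2)

theorem map_word_letterPow_eq_zero {D : leftAlgebra Λ →ₗ[ℂ] leftAlgebra Λ} (hD : IsDerivation D)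
    {a : Λ} (ha : D (gen a) = 0) (k : ℕ) : D (word (letterPow a k)) = 0 := by
  rw [letterPow, _root_.map_pow, word_of, hD.map_pow]
  simp [ha]

/-- In the Leibniz expansion of D on the n-th power of c a^k, the coefficient at `v` reappears at n
distinct words without interference. Bessel's inequality bounds n times its square independently of
n. -/
theorem coeff_map_gen_eq_zero {D : leftAlgebra Λ →ₗ[ℂ] leftAlgebra Λ} (hD : IsNormalDerivation D)
    {a c : Λ} (hac : a ≠ c) (ha : D (gen a) = 0) {v : FreeMonoid Λ}
    (hv : ∀ l, v ≠ FreeMonoid.of c * letterPow a l)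
    (hv' : ∀ l, v ≠ letterPow a l * FreeMonoid.of c) : coeff v (D (gen c)) = 0 := by
  obtain ⟨M, hM⟩ := hD.isOpBounded
  obtain ⟨k, hk⟩ := exists_gt v.length
  have hspaced : D (word (spacedWord a c k)) = D (gen c) * word (letterPow a k) := by
    rw [spacedWord, _root_.map_mul, word_of, hD.1, map_word_letterPow_eq_zero hD.1 ha, mul_zero,
      zero_add]
  have hle : ∀ n : ℕ, (n : ℝ) * ‖coeff v (D (gen c))‖ ^ 2 ≤ M ^ 2 := by
    intro n
    let w : Fin n → FreeMonoid Λ := fun i =>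
      spacedWord a c k ^ (i : ℕ) * v * (letterPow a k * spacedWord a c k ^ (n - 1 - (i : ℕ)))
    have hw : Function.Injective w := fun i j h =>
      Fin.ext (spacedWord_sandwich_inj hac hv hv' hk i.2 j.2 h).1
    have hexp : D (word (spacedWord a c k ^ n)) = ∑ j ∈ Finset.range n,
        word (spacedWord a c k ^ j) * D (gen c) *
          word (letterPow a k * spacedWord a c k ^ (n - 1 - j)) := by
      rw [_root_.map_pow, hD.1.map_pow, hspaced]
      refine Finset.sum_congr rfl fun j _ => ?_
      rw [_root_.map_mul word (letterPow a k), _root_.map_pow word (spacedWord a c k) j,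
        _root_.map_pow word (spacedWord a c k) (n - 1 - j)]
      simp only [mul_assoc]
    have hcoeff : ∀ i, coeff (w i) (D (word (spacedWord a c k ^ n))) = coeff v (D (gen c)) := by
      intro i
      rw [hexp, map_sum, Finset.sum_eq_single (i : ℕ)]
      · exact coeff_word_mul_word _ _ _ _
      · intro j hj hji
        refine coeff_word_mul_word_of_notMem _ fun v' h => hji ?_
        exact (spacedWord_sandwich_inj hac hv hv' hk i.2 (Finset.mem_range.1 hj) h).1.symm
      · exact fun h => absurd (Finset.mem_range.2 i.2) h
    have h1 := sum_norm_coeff_sq_le hw (D (word (spacedWord a c k ^ n)))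
    simp only [hcoeff, Finset.sum_const, Finset.card_univ, Fintype.card_fin, nsmul_eq_mul] at h1
    exact h1.trans (pow_le_pow_left₀ (opNorm_nonneg _) (hM _ (opNorm_word_le _)) 2)
  exact norm_eq_zero.1 (pow_eq_zero_iff two_ne_zero |>.1
    (eq_zero_of_forall_nat_mul_le (sq_nonneg _) hle))

theorem coeff_map_gen_self {D : leftAlgebra Λ →ₗ[ℂ] leftAlgebra Λ} (hD : IsNormalDerivation D)
    (c : Λ) : coeff (FreeMonoid.of c) (D (gen c)) = 0 := by
  simpa only [letterPow, pow_one] using coeff_letterPow_map_gen hD.1 hD.isOpBounded c 1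

/-- For l > 0, writing D(L_c) = L_c T - T L_c, the word a^l c is reached only by the second term and
c a^l only by the first, both through the coefficient of T at a^l. -/
theorem coeff_map_gen_antisymm {D : leftAlgebra Λ →ₗ[ℂ] leftAlgebra Λ} (hD : IsNormalDerivation D)
    {a c : Λ} (hac : a ≠ c) (l : ℕ) :
    coeff (letterPow a l * FreeMonoid.of c) (D (gen c)) =
      - coeff (FreeMonoid.of c * letterPow a l) (D (gen c)) := by
  obtain ⟨T, hT⟩ := exists_map_gen_eq_ad hD c
  cases l with
  | zero => rw [letterPow, pow_zero, one_mul, mul_one, coeff_map_gen_self hD, neg_zero]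
  | succ l =>
    have h1 : coeff (letterPow a (l + 1) * FreeMonoid.of c) (gen c * T) = 0 :=
      coeff_gen_mul_of_notMem _ _ fun w hw => absurd (letterPow_mul_eq_of_mul hac hw) (by omega)
    have h2 : coeff (FreeMonoid.of c * letterPow a (l + 1)) (T * gen c) = 0 :=
      coeff_mul_gen_of_notMem _ _ fun w hw => absurd (mul_letterPow_eq_mul_of hac hw) (by omega)
    rw [hT, ad_apply, map_sub, map_sub, h1, h2, coeff_gen_mul, coeff_mul_gen, zero_sub, sub_zero]

/-! ### Matching the implementing elements of different letters -/

section

variable {D : leftAlgebra Λ →ₗ[ℂ] leftAlgebra Λ} {a c : Λ}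

/-- The two exceptional families of words meet only at c itself, so a word beginning with c is
exceptional only as c a^l. -/
theorem coeff_of_mul_map_gen_eq_zero (hD : IsNormalDerivation D) (hac : a ≠ c)
    (ha : D (gen a) = 0) {v : FreeMonoid Λ} (hv : ∀ l, v ≠ letterPow a l) :
    coeff (FreeMonoid.of c * v) (D (gen c)) = 0 := by
  refine coeff_map_gen_eq_zero hD hac ha (fun l h => hv l (of_mul_inj.1 h).2) fun l h => ?_
  obtain rfl := letterPow_mul_eq_of_mul hac h.symm
  rw [letterPow, pow_zero, one_mul, ← mul_one (FreeMonoid.of c), mul_assoc, of_mul_inj,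
    one_mul] at h
  exact hv 0 h.2

theorem coeff_mul_of_map_gen_eq_zero (hD : IsNormalDerivation D) (hac : a ≠ c)
    (ha : D (gen a) = 0) {v : FreeMonoid Λ} (hv : ∀ l, v ≠ letterPow a l) :
    coeff (v * FreeMonoid.of c) (D (gen c)) = 0 := by
  refine coeff_map_gen_eq_zero hD hac ha (fun l h => ?_) fun l h => hv l (mul_of_inj.1 h).1
  obtain rfl := mul_letterPow_eq_mul_of hac h.symm
  rw [letterPow, pow_zero, mul_one, ← one_mul (FreeMonoid.of c), ← mul_assoc, mul_of_inj,
    mul_one] at h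
  exact hv 0 h.1

/-- The shift f of D(L_c) has coefficients only at powers of a. Thus L_c f recovers the words c a^l
and, by antisymmetry, -f L_c recovers a^l c; the overlap c has coefficient zero. -/
theorem map_gen_eq_ad_backShift (hD : IsNormalDerivation D) (hac : a ≠ c)
    (ha : D (gen a) = 0) : D (gen c) = ad (backShift c (D (gen c))) (gen c) := by
  refine ext_coeff fun w => ?_
  rw [ad_apply, map_sub]
  by_cases hw : ∃ v, w = FreeMonoid.of c * v
  · obtain ⟨v, rfl⟩ := hw
    rw [coeff_gen_mul, coeff_backShift]
    suffices h : coeff (FreeMonoid.of c * v) (backShift c (D (gen c)) * gen c) = 0 by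
      rw [h, sub_zero]
    by_cases hv : ∃ v', FreeMonoid.of c * v = v' * FreeMonoid.of c
    · obtain ⟨v', hv'⟩ := hv
      rw [hv', coeff_mul_gen, coeff_backShift]
      by_cases hp : ∃ l, v' = letterPow a l
      · obtain ⟨l, rfl⟩ := hp
        obtain rfl := letterPow_mul_eq_of_mul hac hv'.symm
        rw [letterPow, pow_zero, mul_one, coeff_map_gen_self hD]
      · exact coeff_of_mul_map_gen_eq_zero hD hac ha (not_exists.1 hp)
    · exact coeff_mul_gen_of_notMem _ _ (not_exists.1 hv)
  · rw [coeff_gen_mul_of_notMem _ _ (not_exists.1 hw), zero_sub]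
    by_cases hv : ∃ v, w = v * FreeMonoid.of c
    · obtain ⟨v, rfl⟩ := hv
      rw [coeff_mul_gen, coeff_backShift]
      by_cases hp : ∃ l, v = letterPow a l
      · obtain ⟨l, rfl⟩ := hp
        exact coeff_map_gen_antisymm hD hac l
      · rw [coeff_of_mul_map_gen_eq_zero hD hac ha (not_exists.1 hp),
          coeff_mul_of_map_gen_eq_zero hD hac ha (not_exists.1 hp), neg_zero]
    · rw [coeff_mul_gen_of_notMem _ _ (not_exists.1 hv), neg_zero]
      exact coeff_map_gen_eq_zero hD hac ha (fun l h => hw ⟨_, h⟩) fun l h => hv ⟨_, h⟩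

/-- An element supported on powers of a commutes with L_a, so correcting D at c does not spoil its
vanishing at a. -/
theorem ad_backShift_gen_eq_zero (hD : IsNormalDerivation D) (hac : a ≠ c)
    (ha : D (gen a) = 0) : ad (backShift c (D (gen c))) (gen a) = 0 := by
  refine ext_coeff fun w => ?_
  rw [ad_apply, map_sub, map_zero]
  by_cases hw : ∃ l, w = letterPow a l
  · obtain ⟨l, rfl⟩ := hw
    cases l with
    | zero =>
      rw [letterPow, pow_zero, coeff_one_gen_mul, coeff_one_mul_gen, sub_zero]
    | succ l =>
      have h1 : coeff (letterPow a (l + 1)) (gen a * backShift c (D (gen c))) =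
          coeff (letterPow a l) (backShift c (D (gen c))) := by
        rw [letterPow, pow_succ', coeff_gen_mul]
      have h2 : coeff (letterPow a (l + 1)) (backShift c (D (gen c)) * gen a) =
          coeff (letterPow a l) (backShift c (D (gen c))) := by
        rw [letterPow, pow_succ, coeff_mul_gen]
      rw [h1, h2, sub_self]
  · have h1 : coeff w (gen a * backShift c (D (gen c))) = 0 := by
      by_cases hv : ∃ v, w = FreeMonoid.of a * v
      · obtain ⟨v, rfl⟩ := hv
        rw [coeff_gen_mul, coeff_backShift]
        refine coeff_of_mul_map_gen_eq_zero hD hac ha fun l hl => hw ⟨l + 1, ?_⟩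
        rw [hl, letterPow, letterPow, pow_succ']
      · exact coeff_gen_mul_of_notMem _ _ (not_exists.1 hv)
    have h2 : coeff w (backShift c (D (gen c)) * gen a) = 0 := by
      by_cases hv : ∃ v, w = v * FreeMonoid.of a
      · obtain ⟨v, rfl⟩ := hv
        rw [coeff_mul_gen, coeff_backShift]
        refine coeff_of_mul_map_gen_eq_zero hD hac ha fun l hl => hw ⟨l + 1, ?_⟩
        rw [hl, letterPow, letterPow, pow_succ]
      · exact coeff_mul_gen_of_notMem _ _ (not_exists.1 hv)
    rw [h1, h2, sub_zero]

theorem map_gen_eq_zero_of_two (hD : IsNormalDerivation D) {b : Λ} (hab : a ≠ b)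
    (ha : D (gen a) = 0) (hb : D (gen b) = 0) (c : Λ) : D (gen c) = 0 := by
  rcases eq_or_ne a c with rfl | hac
  · exact ha
  rcases eq_or_ne b c with rfl | hbc
  · exact hb
  refine ext_coeff fun w => ?_
  rw [map_zero]
  by_contra hne
  -- Powers of two different letters agree only when empty, so the two support conditions together
  -- leave only the word c.
  have hpow : ∀ l m, letterPow a l = letterPow b m → l = 0 := by
    intro l m h
    have h' : letterPow a l * 1 = letterPow b m := by rw [mul_one, h]
    cases m with
    | zero =>
      have := congrArg FreeMonoid.length h
      rwa [length_letterPow, length_letterPow] at this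
    | succ m =>
      rw [letterPow, letterPow, pow_succ' (FreeMonoid.of b)] at h'
      exact letterPow_mul_eq_of_mul hab h'
  by_cases hw : ∃ v, w = FreeMonoid.of c * v
  · obtain ⟨v, rfl⟩ := hw
    by_cases hl : ∃ l, v = letterPow a l
    · by_cases hm : ∃ m, v = letterPow b m
      · obtain ⟨l, rfl⟩ := hl
        obtain ⟨m, hm⟩ := hm
        obtain rfl := hpow l m hm
        rw [letterPow, pow_zero, mul_one] at hne
        exact hne (coeff_map_gen_self hD c)
      · exact hne (coeff_of_mul_map_gen_eq_zero hD hbc hb (not_exists.1 hm))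
    · exact hne (coeff_of_mul_map_gen_eq_zero hD hac ha (not_exists.1 hl))
  · by_cases hv : ∃ v, w = v * FreeMonoid.of c
    · obtain ⟨v, rfl⟩ := hv
      by_cases hl : ∃ l, v = letterPow a l
      · by_cases hm : ∃ m, v = letterPow b m
        · obtain ⟨l, rfl⟩ := hl
          obtain ⟨m, hm⟩ := hm
          obtain rfl := hpow l m hm
          rw [letterPow, pow_zero, one_mul] at hne
          exact hne (coeff_map_gen_self hD c)
        · exact hne (coeff_mul_of_map_gen_eq_zero hD hbc hb (not_exists.1 hm))
      · exact hne (coeff_mul_of_map_gen_eq_zero hD hac ha (not_exists.1 hl))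
    · exact hne (coeff_map_gen_eq_zero hD hac ha (fun l h => hw ⟨_, h⟩) fun l h => hv ⟨_, h⟩)

/-- A normal derivation agrees on all generators with an inner derivation. -/
theorem exists_forall_map_gen_eq_ad [Nonempty Λ] (hD : IsNormalDerivation D) :
    ∃ T : leftAlgebra Λ, ∀ α, (D - ad T) (gen α) = 0 := by
  obtain ⟨a⟩ := ‹Nonempty Λ›
  obtain ⟨T, hT⟩ := exists_map_gen_eq_ad hD a
  have ha : (D - ad T) (gen a) = 0 := by rw [LinearMap.sub_apply, hT, sub_self]
  by_cases h : ∃ b, a ≠ b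
  · obtain ⟨b, hab⟩ := h
    have hD' := hD.sub_ad T
    set D' := D - ad T
    set f := backShift b (D' (gen b))
    refine ⟨T + f, ?_⟩
    have hadd : D - ad (T + f) = D' - ad f := by
      ext1 A
      simp only [D', LinearMap.sub_apply, ad_apply, mul_add, add_mul]
      abel
    rw [hadd]
    refine map_gen_eq_zero_of_two (hD'.sub_ad f) hab ?_ ?_
    · rw [LinearMap.sub_apply, ha, ad_backShift_gen_eq_zero hD' hab ha, sub_zero]
    · rw [LinearMap.sub_apply, sub_eq_zero]
      exact map_gen_eq_ad_backShift hD' hab ha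
  -- With a single letter, no second correction is needed.
  · push Not at h
    exact ⟨T, fun α => h α ▸ ha⟩

end

/-! ### Normal derivations vanishing on the generators -/

/-- Weak form of the identity Σ L_α L_α^* = 1 - P, with P the vacuum projection: every nonempty word
is uniquely a letter times a word. -/
theorem hasSum_inner_star_leftOp (x y : FockSpace Λ) :
    HasSum (fun α => inner ℂ (star (leftOp α) y) (star (leftOp α) x))
      (inner ℂ y x - inner ℂ (y 1) (x 1)) := by
  classical
  let f : FreeMonoid Λ → ℂ := fun w => inner ℂ (y w) (x w)
  let g : (Σ _ : Λ, FreeMonoid Λ) → FreeMonoid Λ := fun p => FreeMonoid.of p.1 * p.2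
  have hg : Function.Injective g := by
    rintro ⟨α, u⟩ ⟨β, v⟩ h
    obtain ⟨rfl, rfl⟩ := of_mul_inj.1 h
    rfl
  have h0 : HasSum (fun w => f w - (Pi.single 1 (f 1) : FreeMonoid Λ → ℂ) w)
      (inner ℂ y x - inner ℂ (y 1) (x 1)) :=
    (lp.hasSum_inner (𝕜 := ℂ) y x).sub (hasSum_pi_single 1 (f 1))
  have h1 := (hg.hasSum_iff (by
    intro w hw
    induction w using FreeMonoid.casesOn with
    | one => simp
    | of_mul α u => exact absurd ⟨⟨α, u⟩, rfl⟩ hw)).2 h0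
  refine h1.sigma fun α => (lp.hasSum_inner (𝕜 := ℂ) (star (leftOp α) y)
    (star (leftOp α) x)).congr_fun fun w => ?_
  simp only [Function.comp_apply, g, f, star_leftOp_apply,
    Pi.single_eq_of_ne (one_ne_of_mul α w).symm, sub_zero]

theorem sum_norm_star_leftOp_sq_le (F : Finset Λ) (x : FockSpace Λ) :
    ∑ α ∈ F, ‖star (leftOp α) x‖ ^ 2 ≤ ‖x‖ ^ 2 := by
  have h := Complex.hasSum_re (hasSum_inner_star_leftOp x x)
  simp only [inner_self_eq_norm_sq_to_K, Complex.sub_re] at h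
  norm_cast at h
  have h' : HasSum (fun α => ‖star (leftOp α) x‖ ^ 2) (‖x‖ ^ 2 - ‖x 1‖ ^ 2) := h
  exact (sum_le_hasSum F (fun _ _ => sq_nonneg _) h').trans (sub_le_self _ (sq_nonneg _))

theorem orthogonalFamily_leftCreation :
    OrthogonalFamily ℂ (fun _ : Λ => FockSpace Λ) leftCreation := by
  intro α β h x y
  change inner ℂ ((leftCreation α).toContinuousLinearMap x) (leftCreation β y) = 0
  rw [← ContinuousLinearMap.adjoint_inner_right]
  have : (leftCreation α).toContinuousLinearMap.adjoint (leftCreation β y) = 0 :=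
    congrArg (fun T : FockSpace Λ →WOT[ℂ] FockSpace Λ => T y) (star_leftOp_mul_leftOp_of_ne h)
  rw [this, inner_zero_right]

theorem backShift_apply_of_coeff_one {A : leftAlgebra Λ} (hA : coeff 1 A = 0) (α : Λ)
    (x : FockSpace Λ) : (backShift α A : FockSpace Λ →WOT[ℂ] FockSpace Λ) x =
      star (leftOp α) ((A : FockSpace Λ →WOT[ℂ] FockSpace Λ) x) := by
  rw [coe_backShift_of_coeff_one hA]
  rfl

theorem sum_gen_mul_backShift_apply {A : leftAlgebra Λ} (hA : coeff 1 A = 0) (F : Finset Λ)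
    (x : FockSpace Λ) :
    ((∑ α ∈ F, gen α * backShift α A : leftAlgebra Λ) : FockSpace Λ →WOT[ℂ] FockSpace Λ) x =
      ∑ α ∈ F, leftCreation α
        (star (leftOp α) ((A : FockSpace Λ →WOT[ℂ] FockSpace Λ) x)) := by
  classical
  induction F using Finset.induction_on with
  | empty => rfl
  | insert α F hα ih =>
    rw [Finset.sum_insert hα, Finset.sum_insert hα, ← ih, ← backShift_apply_of_coeff_one hA]
    rfl

/-- A uniform bound over finite sets is needed because normality gives continuity only on the ball.
It holds since the ranges of the L_α are orthogonal. -/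
theorem opNorm_sum_gen_mul_backShift_le {A : leftAlgebra Λ} (hA : coeff 1 A = 0)
    (F : Finset Λ) : opNorm (∑ α ∈ F, gen α * backShift α A) ≤ opNorm A := by
  refine ContinuousLinearMap.opNorm_le_bound _ (opNorm_nonneg A) fun x => ?_
  refine le_trans ?_ (norm_apply_le A x)
  rw [ContinuousLinearMapWOT.toCLM_apply, sum_gen_mul_backShift_apply hA]
  refine le_of_sq_le_sq ?_ (norm_nonneg _)
  rw [orthogonalFamily_leftCreation.norm_sum]
  exact sum_norm_star_leftOp_sq_le F _

theorem tendsto_sum_gen_mul_backShift {A : leftAlgebra Λ} (hA : coeff 1 A = 0) :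
    Tendsto (fun F : Finset Λ => ∑ α ∈ F, gen α * backShift α A) atTop (𝓝 A) := by
  refine tendsto_subtype_rng.2 ?_
  rw [ContinuousLinearMapWOT.tendsto_iff_forall_inner_apply_tendsto]
  intro x y
  have h := hasSum_inner_star_leftOp ((A : FockSpace Λ →WOT[ℂ] FockSpace Λ) x) y
  rw [apply_one, hA, zero_mul, inner_zero_right, sub_zero] at h
  refine Tendsto.congr (fun F => ?_) h
  rw [sum_gen_mul_backShift_apply hA, inner_sum]
  refine Finset.sum_congr rfl fun α _ => ?_
  exact ContinuousLinearMap.adjoint_inner_left (leftCreation α).toContinuousLinearMap _ y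

theorem coeff_map_eq_zero_of_forall_backShift {D : leftAlgebra Λ →ₗ[ℂ] leftAlgebra Λ}
    (hD : IsNormalDerivation D) (hgen : ∀ α, D (gen α) = 0) {w : FreeMonoid Λ} {A : leftAlgebra Λ}
    (h : ∀ α, coeff w (gen α * D (backShift α A)) = 0) : coeff w (D A) = 0 := by
  set A' : leftAlgebra Λ := A - coeff 1 A • 1
  have hA' : coeff 1 A' = 0 := by
    rw [map_sub, map_smul, coeff_one_one, smul_eq_mul, mul_one, sub_self]
  have hDA : D A' = D A := by rw [map_sub, map_smul, hD.1.map_one, smul_zero, sub_zero]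
  have hshift : ∀ α, backShift α A' = backShift α A := fun α => ext_coeff fun u => by
    rw [coeff_backShift, coeff_backShift, map_sub, map_smul,
      coeff_one_ne (one_ne_of_mul α u).symm, smul_zero, sub_zero]
  -- Rescaling brings `A'` and all its partial sums into the unit ball; the added 1 keeps the
  -- divisor positive.
  let c : ℂ := (((opNorm A' + 1)⁻¹ : ℝ) : ℂ)
  have hpos : 0 < opNorm A' + 1 := by linarith [opNorm_nonneg A']
  have hc : c ≠ 0 := Complex.ofReal_ne_zero.2 (inv_ne_zero hpos.ne')
  have hball : ∀ B : leftAlgebra Λ, opNorm B ≤ opNorm A' → c • B ∈ unitBall Λ := fun B hB => by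
    rw [mem_unitBall, opNorm_smul, Complex.norm_real, Real.norm_of_nonneg (by positivity),
      inv_mul_le_iff₀ hpos]
    linarith
  have hlim := ((continuous_coeff w).tendsto _).comp ((hD.2 _ (hball A' le_rfl)).tendsto.comp
    (tendsto_nhdsWithin_iff.2 ⟨(tendsto_sum_gen_mul_backShift hA').const_smul c,
      Eventually.of_forall fun F => hball _ (opNorm_sum_gen_mul_backShift_le hA' F)⟩))
  have hz := tendsto_nhds_unique hlim ((tendsto_const_nhds (x := (0 : ℂ))).congr fun F => by
    simp only [Function.comp_apply, map_smul, map_sum, hD.1 _ _, hgen, zero_mul, add_zero, hshift,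
      h, Finset.sum_const_zero, smul_zero])
  rw [map_smul, map_smul, hDA, smul_eq_mul] at hz
  exact (mul_eq_zero.1 hz).resolve_left hc

/-- Since D(L_α S_α A) = L_α D(S_α A), the coefficient at the empty word vanishes, and the one at βu
is that of D(S_β A) at u. -/
theorem eq_zero_of_forall_map_gen_eq_zero {D : leftAlgebra Λ →ₗ[ℂ] leftAlgebra Λ}
    (hD : IsNormalDerivation D) (hgen : ∀ α, D (gen α) = 0) : D = 0 := by
  ext1 A
  refine ext_coeff fun w => ?_
  rw [LinearMap.zero_apply, map_zero]
  induction w using FreeMonoid.inductionOn' generalizing A with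
  | one => exact coeff_map_eq_zero_of_forall_backShift hD hgen fun α => coeff_one_gen_mul α _
  | of_mul β u ih =>
    refine coeff_map_eq_zero_of_forall_backShift hD hgen fun α => ?_
    rcases eq_or_ne β α with rfl | hne
    · rw [coeff_gen_mul]
      exact ih _
    · exact coeff_gen_mul_of_notMem _ _ fun v hv => hne (of_mul_inj.1 hv).1

/-- Every normal derivation of the left regular free semigroup algebra is inner. -/
theorem IsNormalDerivation.isInner [Nonempty Λ] {D : leftAlgebra Λ →ₗ[ℂ] leftAlgebra Λ}
    (hD : IsNormalDerivation D) : IsInner D := by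
  obtain ⟨T, hT⟩ := exists_forall_map_gen_eq_ad hD
  have h := sub_eq_zero.1 (eq_zero_of_forall_map_gen_eq_zero (hD.sub_ad T) hT)
  exact ⟨T, fun A => by rw [h, ad_apply]⟩

end

end FreeSemigroupAlgebra

theorem mainTheorem2 (Λ : Type*) [Nonempty Λ] :
    (∀ D : FreeSemigroupAlgebra.leftAlgebra Λ →ₗ[ℂ] FreeSemigroupAlgebra.leftAlgebra Λ,
      FreeSemigroupAlgebra.IsNormalDerivation D → FreeSemigroupAlgebra.IsInner D) ∧
    Subsingleton (FreeSemigroupAlgebra.firstNormalCohomology Λ) := by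
  refine ⟨fun D hD => hD.isInner, ?_⟩
  refine Submodule.Quotient.subsingleton_iff.2 ?_
  rw [Submodule.submoduleOf, Submodule.comap_subtype_eq_top]
  exact fun D hD => FreeSemigroupAlgebra.IsNormalDerivation.isInner hD
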